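/- **Setup.** Let $\mathrm E=\{(0),(ij),(k)\mid 1\le i<j\le 5,\ 1\le k\le 5\}$ (sixteen elements) and $\hat{\mathrm E}=\mathrm E\times\mathbb Z$, with elements written $\alpha^r$. Give $\hat{\mathrm E}$ the partial order generated by the arrows, for all $r\in\mathbb Z$, $(0)^r\to(12)^r\to(13)^r$; $(13)^r\to(23)^r,(14)^r$; $(23)^r\to(24)^r$; $(14)^r\to(24)^r,(15)^r$; $(24)^r\to(34)^r,(25)^r$; $(15)^r\to(25)^r$; $(34)^r\to(5)^r,(35)^r$; $(25)^r\to(35)^r$; $(5)^r\to(4)^r$; $(35)^r\to(4)^r,(45)^r$; $(4)^r\to(3)^r$; $(45)^r\to(3)^r$; $(3)^r\to(2)^r\to(1)^r$; and $(45)^r\to(0)^{r+1}$, $(3)^r\to(12)^{r+1}$, $(2)^r\to(13)^{r+1}$, $(1)^r\to(23)^{r+1}$; that is, $\hat\alpha\le\hat\beta$ if there is a directed path from $\hat\alpha$ to $\hat\beta$. For $\hat\delta,\hat\delta'\in\hat{\mathrm E}$ let $[\hat\delta,\hat\delta']=\{\hat\alpha\mid\hat\delta\le\hat\alpha\le\hat\delta'\}$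 (a finite set) and $P_{\hat\delta}^{\hat\delta'}=\mathbb C[\lambda^{\hat\alpha}\mid\hat\alpha\in[\hat\delta,\hat\delta']]$. With $\lambda=\lambda^{(0)}$, $w_{ij}=\lambda^{(ij)}$, $p_k=\lambda^{(k)}$, the ten pure spinor quadrics are $$\begin{aligned} \Gamma^{1}&=\lambda p_1+w_{25}w_{34}-w_{24}w_{35}+w_{23}w_{45}, & \Gamma^{1^*}&=-p_2w_{12}+p_3w_{13}-p_4w_{14}+p_5w_{15},\\ \Gamma^{2}&=-\lambda p_2-w_{15}w_{34}+w_{14}w_{35}-w_{13}w_{45}, & \Gamma^{2^*}&=-p_1w_{12}+p_3w_{23}-p_4w_{24}+p_5w_{25},\\ \Gamma^{3}&=\lambda p_3+w_{15}w_{24}-w_{14}w_{25}+w_{12}w_{45}, & \Gamma^{3^*}&=-p_1w_{13}+p_2w_{23}-p_4w_{34}+p_5w_{35},\\ \Gamma^{4}&=-\lambda p_4-w_{15}w_{23}+w_{13}w_{25}-w_{12}w_{35}, & \Gamma^{4^*}&=-p_1w_{14}+p_2w_{24}-p_3w_{34}+p_5w_{45},\\ \Gamma^{5}&=\lambda p_5+w_{14}w_{23}-w_{13}w_{24}+w_{12}w_{34},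 & \Gamma^{5^*}&=-p_1w_{15}+p_2w_{25}-p_3w_{35}+p_4w_{45}. \end{aligned}$$ For $\mathbf s\in\{1,\dots,5,1^*,\dots,5^*\}$ and $l\in\mathbb Z$, the affinized quadric $\Gamma^{\mathbf s^l}\in P_{\hat\delta}^{\hat\delta'}$ is the coefficient of $z^l$ in $\Gamma^{\mathbf s}$ evaluated at the generating functions $\lambda^{\alpha}(z)=\sum_{l:\ \alpha^l\in[\hat\delta,\hat\delta']}\lambda^{\alpha^l}z^l$, $\alpha\in\mathrm E$. Let $I_{\hat\delta}^{\hat\delta'}$ be the ideal generated by all $\Gamma^{\mathbf s^l}$, and $A_{\hat\delta}^{\hat\delta'}=P_{\hat\delta}^{\hat\delta'}/I_{\hat\delta}^{\hat\delta'}$, graded by $\deg\lambda^{\hat\alpha}=1$. Order the generators totally by restricting $$\begin{aligned}\cdots&<(4)^{r-1}<(0)^r<(3)^{r-1}<(12)^r<(2)^{r-1}<(13)^r<(1)^{r-1}<(14)^r<(23)^r<(15)^r<(24)^r\\&<(25)^r<(34)^r<(35)^r<(5)^r<(45)^r<(4)^r<(0)^{r+1}<\cdots,\end{aligned}$$ and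 order the monomials degree-lexicographically: write each monomial as a word $\lambda^{\hat\alpha_1}\cdots\lambda^{\hat\alpha_k}$ with its letters in increasing order $\hat\alpha_1\le\dots\le\hat\alpha_k$, compare words first by length, and words of equal length lexicographically from the left, a smaller letter at the first difference giving the smaller monomial. **Corollary.** For all $\hat\delta,\hat\delta'\in\hat{\mathrm E}$: 1. the quadrics $\Gamma^{\mathbf s^l}$ ($\mathbf s\in\{1,\dots,5,1^*,\dots,5^*\}$, $l\in\mathbb Z$) form a quadratic Gröbner basis of $I_{\hat\delta}^{\hat\delta'}$ for this monomial order: they are homogeneous of degree two, they lie in $I_{\hat\delta}^{\hat\delta'}$, and their leading terms generate the ideal generated by the leading terms of all elements of $I_{\hat\delta}^{\hat\delta'}$; 2. $A_{\hat\delta}^{\hat\delta'}$ is a Koszul algebra over $\mathbb C$: it is a connected graded algebra and the trivial module $\mathbb C=A/A_+$ has a linear graded free resolution $\cdots\to A(-2)^{b_2}\to A(-1)^{b_1}\to A^{b_0}\to\mathbb C\to0$. -/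

import Mathlib

universe u

/-! ## The poset of affine spinor weights -/

/-- The sixteen weights of the half-spin representation `S` of `Spin(10)`:
`w0` is `(0)`, `wij` is `(ij)` for `1 ≤ i < j ≤ 5`, and `pk` is `(k)` for `1 ≤ k ≤ 5`. -/
inductive SpinWt : Type
  | w0
  | w12 | w13 | w14 | w15 | w23 | w24 | w25 | w34 | w35 | w45
  | p1 | p2 | p3 | p4 | p5
  deriving DecidableEq

/-- The ten labels `1, …, 5, 1*, …, 5*` of the weight basis of the vector representation of
`SO(10)`; `vi` is `i` and `ui` is `i*`. -/
inductive VecWt : Type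
  | v1 | v2 | v3 | v4 | v5
  | u1 | u2 | u3 | u4 | u5
  deriving DecidableEq

/-- The set `Ê = E × ℤ`; the element `⟨α, r⟩` is `α^r`. -/
@[ext] structure AffWt : Type where
  /-- the underlying finite weight -/
  wt : SpinWt
  /-- the power of the loop parameter -/
  lvl : ℤ
  deriving DecidableEq

namespace SpinWt

instance : Fintype SpinWt where
  elems := {w0, w12, w13, w14, w15, w23, w24, w25, w34, w35, w45, p1, p2, p3, p4, p5}
  complete a := by cases a <;> decide

/-- The arrows `α → β` of the finite Hasse diagram `E`. -/
def arrows : List (SpinWt × SpinWt) :=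
  [(w0, w12), (w12, w13), (w13, w23), (w13, w14), (w23, w24), (w14, w24), (w14, w15),
   (w24, w34), (w24, w25), (w15, w25), (w34, p5), (w34, w35), (w25, w35), (p5, p4),
   (w35, p4), (w35, w45), (p4, p3), (w45, p3), (p3, p2), (p2, p1)]

/-- The pairs `(α, β)` giving the arrows `α^r → β^(r+1)` of the affine Hasse diagram `Ê`. -/
def loopArrows : List (SpinWt × SpinWt) :=
  [(w45, w0), (p3, w12), (p2, w13), (p1, w23)]

/-- The height of a finite weight in the Hasse diagram. -/
def ht : SpinWt → ℤ
  | w0 => 0 | w12 => 1 | w13 => 2 | w14 => 3 | w23 => 3 | w15 => 4 | w24 => 4 | w25 => 5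
  | w34 => 5 | w35 => 6 | p5 => 6 | w45 => 7 | p4 => 7 | p3 => 8 | p2 => 9 | p1 => 10

/-- The position of `α^0` in the total order
`… < (4)^(r-1) < (0)^r < (3)^(r-1) < (12)^r < (2)^(r-1) < (13)^r < (1)^(r-1) < (14)^r < (23)^r
< (15)^r < (24)^r < (25)^r < (34)^r < (35)^r < (5)^r < (45)^r < (4)^r < (0)^(r+1) < …`,
counted from `(0)^0`; the pattern repeats with period sixteen. -/
def pos : SpinWt → ℤ
  | w0 => 0 | w12 => 2 | w13 => 4 | w14 => 6 | w23 => 7 | w15 => 8 | w24 => 9 | w25 => 10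
  | w34 => 11 | w35 => 12 | p5 => 13 | w45 => 14 | p4 => 15 | p3 => 17 | p2 => 19 | p1 => 21

theorem ht_arrow : ∀ p ∈ arrows, p.2.ht = p.1.ht + 1 := by
  simp [arrows, ht]

theorem ht_loopArrow : ∀ p ∈ loopArrows, p.2.ht + 8 = p.1.ht + 1 := by
  simp [loopArrows, ht]

theorem ht_bounds : ∀ a : SpinWt, 0 ≤ a.ht ∧ a.ht ≤ 10 := by
  intro a; cases a <;> decide

theorem pos_mod : ∀ a b : SpinWt, (a.pos - b.pos) % 16 = 0 → a = b := by
  intro a b; cases a <;> cases b <;> decide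

end SpinWt

namespace AffWt

/-- The arrows of the affine Hasse diagram `Ê`. -/
def Arrow (x y : AffWt) : Prop :=
  (y.lvl = x.lvl ∧ (x.wt, y.wt) ∈ SpinWt.arrows) ∨
    (y.lvl = x.lvl + 1 ∧ (x.wt, y.wt) ∈ SpinWt.loopArrows)

/-- The height function on `Ê`. -/
def ht (x : AffWt) : ℤ := x.wt.ht + 8 * x.lvl

theorem ht_arrow {x y : AffWt} (h : Arrow x y) : y.ht = x.ht + 1 := by
  rcases h with ⟨hl, ha⟩ | ⟨hl, ha⟩
  · have h1 := SpinWt.ht_arrow _ ha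
    simp only [ht] at h1 ⊢
    omega
  · have h1 := SpinWt.ht_loopArrow _ ha
    simp only [ht] at h1 ⊢
    omega

theorem eq_or_ht_lt {x y : AffWt} (h : Relation.ReflTransGen Arrow x y) :
    x = y ∨ x.ht < y.ht := by
  induction h with
  | refl => exact Or.inl rfl
  | tail _ hbc ih =>
    have h1 := ht_arrow hbc
    rcases ih with rfl | ih
    · right; omega
    · right; omega

/-- `x ≤ y` if there is a directed path from `x` to `y` in the Hasse diagram `Ê`. -/
instance : PartialOrder AffWt where
  le x y := Relation.ReflTransGen Arrow x y
  le_refl _ := Relation.ReflTransGen.refl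
  le_trans _ _ _ h1 h2 := h1.trans h2
  le_antisymm x y h1 h2 := by
    rcases eq_or_ht_lt h1 with h | h
    · exact h
    · rcases eq_or_ht_lt h2 with h' | h'
      · exact h'.symm
      · omega

theorem ht_mono {x y : AffWt} (h : x ≤ y) : x.ht ≤ y.ht := by
  rcases eq_or_ht_lt h with h | h
  · rw [h]
  · exact h.le

/-- Intervals of `Ê` are finite. -/
instance finite_Icc (x y : AffWt) : Finite (Set.Icc x y) := by
  have hfin : (Set.Icc (x.ht - 10) (y.ht + 10)).Finite := Set.finite_Icc _ _
  have : Finite (Set.Icc (x.ht - 10) (y.ht + 10)) := hfin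
  refine Finite.of_injective
    (β := SpinWt × Set.Icc (x.ht - 10) (y.ht + 10))
    (fun z => (z.1.wt, ⟨8 * z.1.lvl, ?_⟩)) ?_
  · have h1 := ht_mono z.2.1
    have h2 := ht_mono z.2.2
    have h3 := SpinWt.ht_bounds z.1.wt
    simp only [ht] at h1 h2 h3 ⊢
    constructor <;> omega
  · rintro ⟨a, ha⟩ ⟨b, hb⟩ hab
    simp only [Prod.mk.injEq, Subtype.mk.injEq] at hab
    have h8 : a.lvl = b.lvl := by
      have := hab.2
      omega
    exact Subtype.ext (AffWt.ext hab.1 h8)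

noncomputable instance fintypeIcc (x y : AffWt) : Fintype (Set.Icc x y) := Fintype.ofFinite _

/-- The position of `α^r` in the total order on generators. -/
def pos (x : AffWt) : ℤ := x.wt.pos + 16 * x.lvl

theorem pos_injective : Function.Injective pos := by
  intro x y h
  simp only [pos] at h
  have h1 : x.wt = y.wt := SpinWt.pos_mod _ _ (by omega)
  rw [h1] at h
  exact AffWt.ext h1 (by omega)

/-- The total order on the generators indexed by the interval `[δ, δ']`. -/
noncomputable abbrev genOrder (δ δ' : AffWt) : LinearOrder (Set.Icc δ δ') :=
  LinearOrder.lift' (fun x => pos x.1) (pos_injective.comp Subtype.val_injective)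

end AffWt

/-! ## The degree-lexicographic order on monomials -/

/-- A copy of the exponent vectors `σ →₀ ℕ`, to carry the monomial order `wordOrder`. -/
@[ext] structure WordDegLex (σ : Type*) where
  /-- the exponent vector -/
  exps : σ →₀ ℕ

namespace WordDegLex

variable {σ : Type*}

/-- The bijection with exponent vectors. -/
def equiv : (σ →₀ ℕ) ≃ WordDegLex σ where
  toFun a := ⟨a⟩
  invFun a := a.exps

noncomputable instance : AddCommMonoid (WordDegLex σ) := equiv.symm.addCommMonoid

theorem exps_add (a b : WordDegLex σ) : (a + b).exps = a.exps + b.exps := rfl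

/-- The comparison key: first the total degree; in equal degrees the smallest letter at which
the exponents differ decides, and there the *larger* exponent gives the *smaller* monomial. -/
noncomputable def key (a : WordDegLex σ) : ℕ ×ₗ (Lex (σ →₀ ℕ))ᵒᵈ :=
  toLex (a.exps.degree, OrderDual.toDual (toLex a.exps))

theorem key_injective : Function.Injective (key (σ := σ)) := by
  intro a b h
  have h2 := congrArg (fun t => ofLex (OrderDual.ofDual (ofLex t).2)) h
  exact WordDegLex.ext h2

variable [LinearOrder σ]

noncomputable instance : LinearOrder (WordDegLex σ) := LinearOrder.lift' key key_injective

theorem le_iff {a b : WordDegLex σ} :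
    a ≤ b ↔ a.exps.degree < b.exps.degree ∨
      a.exps.degree = b.exps.degree ∧ toLex b.exps ≤ toLex a.exps := by
  change key a ≤ key b ↔ _
  simp [key, Prod.Lex.toLex_le_toLex]

instance : IsOrderedAddMonoid (WordDegLex σ) where
  add_le_add_left a b h c := by
    rw [le_iff] at h ⊢
    simpa [exps_add, map_add] using h

/-- The additive bijection with exponent vectors. -/
noncomputable def addEquiv : (σ →₀ ℕ) ≃+ WordDegLex σ where
  toEquiv := equiv
  map_add' _ _ := rfl

theorem addEquiv_monotone : Monotone (addEquiv (σ := σ)) := by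
  intro a b h
  obtain ⟨c, rfl⟩ := exists_add_of_le h
  rw [le_iff]
  change a.degree < (a + c).degree ∨ a.degree = (a + c).degree ∧ toLex (a + c) ≤ toLex a
  by_cases hc : c = 0
  · right; simp [hc]
  · left
    have : 0 < c.degree := Nat.pos_of_ne_zero fun h0 => hc ((Finsupp.degree_eq_zero_iff c).1 h0)
    rw [map_add]
    omega

theorem wellFoundedLT [Finite σ] : WellFoundedLT (WordDegLex σ) := by
  have : WellQuasiOrderedLE (WordDegLex σ) :=
    addEquiv_monotone.wellQuasiOrderedLE_of_wellQuasiOrderedLE_of_surjective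
      (addEquiv (σ := σ)).surjective
  infer_instance

end WordDegLex

/-- The degree-lexicographic monomial order on commutative monomials in totally ordered
letters: each monomial is written as a word `x₁ x₂ ⋯ xₖ` with `x₁ ≤ x₂ ≤ ⋯ ≤ xₖ`; words are
compared first by length and then lexicographically from the left. -/
noncomputable def wordOrder (σ : Type*) [LinearOrder σ] [Finite σ] : MonomialOrder σ where
  syn := WordDegLex σ
  toSyn := WordDegLex.addEquiv
  toSyn_monotone := WordDegLex.addEquiv_monotone
  wellFoundedLT_syn := WordDegLex.wellFoundedLT

/-! ## Quadratic Gröbner bases and Koszul algebras -/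

/-- `G` is a Gröbner basis of the ideal `I` for the monomial order `m`: `G` lies in `I`, and the
leading terms of the elements of `G` generate the ideal of all leading terms of `I`.  It is
quadratic if all its elements are homogeneous of degree two. -/
structure IsQuadraticGroebnerBasis {σ k : Type*} [Field k] (m : MonomialOrder σ)
    (G : Set (MvPolynomial σ k)) (I : Ideal (MvPolynomial σ k)) : Prop where
  subset : G ⊆ I
  quadratic : ∀ g ∈ G, g.IsHomogeneous 2
  span_leadingTerm : Ideal.span (m.leadingTerm '' G) = Ideal.span (m.leadingTerm '' I)

/-- The ideal of a graded algebra generated by the elements of positive degree. -/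
def positiveIdeal {k A : Type*} [Field k] [CommRing A] [Algebra k A]
    (𝒜 : ℕ → Submodule k A) : Ideal A :=
  Ideal.span {a | ∃ n, 0 < n ∧ a ∈ 𝒜 n}

/-- The graded algebra `A = ⨁ 𝒜 n` over the field `k` is Koszul: it is connected (`𝒜 0 = k`),
and the trivial module `k = A / A₊` has a linear free resolution
`⋯ → A(-2)^(b 2) → A(-1)^(b 1) → A^(b 0) → k → 0`, i.e. an exact sequence of free modules in
which the differentials are given by matrices with entries in `𝒜 1`. -/
structure IsKoszul {k : Type*} {A : Type u} [Field k] [CommRing A] [Algebra k A]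
    (𝒜 : ℕ → Submodule k A) : Prop where
  graded : SetLike.GradedMonoid 𝒜
  internal : DirectSum.IsInternal 𝒜
  nontrivial : Nontrivial A
  connected : 𝒜 0 = 1
  linear : ∃ (b : ℕ → Type u) (d : ∀ n, (b (n + 1) →₀ A) →ₗ[A] (b n →₀ A))
    (ε : (b 0 →₀ A) →ₗ[A] A ⧸ positiveIdeal 𝒜),
    (∀ n i j, d n (Finsupp.single i 1) j ∈ 𝒜 1) ∧
    Function.Surjective ε ∧
    Function.Exact (d 0) ε ∧
    ∀ n, Function.Exact (d (n + 1)) (d n)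

/-! ## The affinized quadrics and the algebras of Richardson varieties -/

/-- The ten quadrics `Γ^s(lam)` cutting out the cone of pure spinors, in the coordinates `lam α`,
`α ∈ E`, of the spinor; they are the components of the `Spin(10)`-map `Sym² S → V`. -/
def pureSpinorQuadric {R : Type*} [CommRing R] (lam : SpinWt → R) : VecWt → R
  | .v1 => lam .w0 * lam .p1 + lam .w25 * lam .w34 - lam .w24 * lam .w35 + lam .w23 * lam .w45
  | .v2 => -(lam .w0 * lam .p2) - lam .w15 * lam .w34 + lam .w14 * lam .w35 - lam .w13 * lam .w45
  | .v3 => lam .w0 * lam .p3 + lam .w15 * lam .w24 - lam .w14 * lam .w25 + lam .w12 * lam .w45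
  | .v4 => -(lam .w0 * lam .p4) - lam .w15 * lam .w23 + lam .w13 * lam .w25 - lam .w12 * lam .w35
  | .v5 => lam .w0 * lam .p5 + lam .w14 * lam .w23 - lam .w13 * lam .w24 + lam .w12 * lam .w34
  | .u1 => -(lam .p2 * lam .w12) + lam .p3 * lam .w13 - lam .p4 * lam .w14 + lam .p5 * lam .w15
  | .u2 => -(lam .p1 * lam .w12) + lam .p3 * lam .w23 - lam .p4 * lam .w24 + lam .p5 * lam .w25
  | .u3 => -(lam .p1 * lam .w13) + lam .p2 * lam .w23 - lam .p4 * lam .w34 + lam .p5 * lam .w35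
  | .u4 => -(lam .p1 * lam .w14) + lam .p2 * lam .w24 - lam .p3 * lam .w34 + lam .p5 * lam .w45
  | .u5 => -(lam .p1 * lam .w15) + lam .p2 * lam .w25 - lam .p3 * lam .w35 + lam .p4 * lam .w45

namespace AffWt

/-- The polynomial algebra `P` on the generators `λ^α̂`, `α̂ ∈ [δ, δ']`. -/
abbrev PolyAlg (δ δ' : AffWt) : Type := MvPolynomial (Set.Icc δ δ') ℂ

/-- The generating function `λ^α(z) = ∑ λ^(α^l) z^l`, the sum over all `l` such that
`α^l ∈ [δ, δ']`, a Laurent polynomial in `z`. -/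
noncomputable def genFun (δ δ' : AffWt) (α : SpinWt) : LaurentPolynomial (PolyAlg δ δ') :=
  ∑ x : Set.Icc δ δ' with x.1.wt = α,
    LaurentPolynomial.C (MvPolynomial.X x) * LaurentPolynomial.T x.1.lvl

/-- The affinized quadric `Γ^(s^l)`: the coefficient of `z^l` in `Γ^s(λ(z))`. -/
noncomputable def quadric (δ δ' : AffWt) (s : VecWt) (l : ℤ) : PolyAlg δ δ' :=
  (pureSpinorQuadric (genFun δ δ') s).coeff l

/-- The set of all affinized quadrics. -/
noncomputable def quadrics (δ δ' : AffWt) : Set (PolyAlg δ δ') :=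
  {g | ∃ (s : VecWt) (l : ℤ), g = quadric δ δ' s l}

/-- The ideal of relations. -/
noncomputable def relIdeal (δ δ' : AffWt) : Ideal (PolyAlg δ δ') := Ideal.span (quadrics δ δ')

/-- The algebra `A` of the interval `[δ, δ']`. -/
abbrev RichAlg (δ δ' : AffWt) : Type := PolyAlg δ δ' ⧸ relIdeal δ δ'

/-- The grading of `A`: the `n`-th component is the image of the homogeneous polynomials of
degree `n`. -/
noncomputable def richGrading (δ δ' : AffWt) (n : ℕ) : Submodule ℂ (RichAlg δ δ') :=
  (MvPolynomial.homogeneousSubmodule (Set.Icc δ δ') ℂ n).map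
    (Ideal.Quotient.mkₐ ℂ (relIdeal δ δ')).toLinearMap

/-- The degree-lexicographic monomial order on `P` extending the total order on generators. -/
noncomputable def monomialOrder (δ δ' : AffWt) : MonomialOrder (Set.Icc δ δ') :=
  @wordOrder (Set.Icc δ δ') (genOrder δ δ') inferInstance

end AffWt

namespace SpinWt

/-- The position of `α^0` in a linear extension of the order on `Ê`; together with `rightPos`
it realizes the order. -/
def leftPos : SpinWt → ℤ
  | w0 => 0 | w12 => 1 | w13 => 2 | w23 => 3 | w14 => 4 | w24 => 5 | w34 => 6 | p5 => 7
  | w15 => 8 | w25 => 9 | w35 => 10 | p4 => 11 | w45 => 12 | p3 => 13 | p2 => 14 | p1 => 15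

/-- The position of `α^0` in the second linear extension realizing the order on `Ê`. -/
def rightPos : SpinWt → ℤ
  | w0 => 0 | w12 => 4 | w13 => 6 | w14 => 7 | w15 => 8 | w23 => 10 | w24 => 11 | w25 => 12
  | w34 => 13 | w35 => 14 | w45 => 15 | p5 => 17 | p4 => 18 | p3 => 19 | p2 => 21 | p1 => 25

/-- The targets `β^k` of the arrows starting at `α^0` (repeated if there is only one). -/
def covers : SpinWt → (SpinWt × ℤ) × (SpinWt × ℤ)
  | w0 => ((w12, 0), (w12, 0)) | w12 => ((w13, 0), (w13, 0)) | w13 => ((w23, 0), (w14, 0))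
  | w14 => ((w24, 0), (w15, 0)) | w15 => ((w25, 0), (w25, 0)) | w23 => ((w24, 0), (w24, 0))
  | w24 => ((w34, 0), (w25, 0)) | w25 => ((w35, 0), (w35, 0)) | w34 => ((p5, 0), (w35, 0))
  | w35 => ((p4, 0), (w45, 0)) | w45 => ((p3, 0), (w0, 1)) | p1 => ((w23, 1), (w23, 1))
  | p2 => ((p1, 0), (w13, 1)) | p3 => ((p2, 0), (w12, 1)) | p4 => ((p3, 0), (p3, 0))
  | p5 => ((p4, 0), (p4, 0))

end SpinWt

namespace AffWt

/-- The extension of `SpinWt.leftPos` to `Ê`. -/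
def leftPos (x : AffWt) : ℤ := x.wt.leftPos + 16 * x.lvl

/-- The extension of `SpinWt.rightPos` to `Ê`. -/
def rightPos (x : AffWt) : ℤ := x.wt.rightPos + 16 * x.lvl

theorem pos_lt_of_arrow {x y : AffWt} (h : Arrow x y) :
    x.leftPos < y.leftPos ∧ x.rightPos < y.rightPos ∧ x.pos < y.pos := by
  obtain ⟨a, r⟩ := x
  obtain ⟨b, q⟩ := y
  simp only [Arrow, SpinWt.arrows, SpinWt.loopArrows, List.mem_cons, Prod.mk.injEq,
    List.not_mem_nil, or_false] at h
  rcases h with ⟨rfl, h⟩ | ⟨rfl, h⟩ <;> casesm* _ ∨ _ <;> obtain ⟨rfl, rfl⟩ := h <;>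
    simp only [leftPos, rightPos, pos, SpinWt.leftPos, SpinWt.rightPos, SpinWt.pos] <;> omega

theorem exists_arrow {x y : AffWt} (hne : x ≠ y) (hl : x.leftPos ≤ y.leftPos)
    (hr : x.rightPos ≤ y.rightPos) :
    ∃ c, Arrow x c ∧ c.leftPos ≤ y.leftPos ∧ c.rightPos ≤ y.rightPos := by
  obtain ⟨a, r⟩ := x
  obtain ⟨b, q⟩ := y
  have h₁ : Arrow ⟨a, r⟩ ⟨a.covers.1.1, r + a.covers.1.2⟩ := by
    cases a <;> simp [Arrow, SpinWt.covers, SpinWt.arrows, SpinWt.loopArrows]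
  have h₂ : Arrow ⟨a, r⟩ ⟨a.covers.2.1, r + a.covers.2.2⟩ := by
    cases a <;> simp [Arrow, SpinWt.covers, SpinWt.arrows, SpinWt.loopArrows]
  have h : (leftPos ⟨a.covers.1.1, r + a.covers.1.2⟩ ≤ leftPos ⟨b, q⟩ ∧
      rightPos ⟨a.covers.1.1, r + a.covers.1.2⟩ ≤ rightPos ⟨b, q⟩) ∨
      (leftPos ⟨a.covers.2.1, r + a.covers.2.2⟩ ≤ leftPos ⟨b, q⟩ ∧
      rightPos ⟨a.covers.2.1, r + a.covers.2.2⟩ ≤ rightPos ⟨b, q⟩) := by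
    clear h₁ h₂
    cases a <;> cases b <;>
      simp only [leftPos, rightPos, SpinWt.leftPos, SpinWt.rightPos, SpinWt.covers, ne_eq,
        mk.injEq, true_and, false_and, not_false_eq_true, reduceCtorEq] at * <;> omega
  rcases h with h | h
  exacts [⟨_, h₁, h⟩, ⟨_, h₂, h⟩]

theorem le_iff {x y : AffWt} : x ≤ y ↔ x.leftPos ≤ y.leftPos ∧ x.rightPos ≤ y.rightPos := by
  constructor
  · intro h
    change Relation.ReflTransGen Arrow x y at h
    induction h with
    | refl => exact ⟨le_rfl, le_rfl⟩
    | tail _ h ih =>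
      have := pos_lt_of_arrow h
      omega
  · rintro ⟨hl, hr⟩
    induction hn : (y.leftPos - x.leftPos).toNat using Nat.strong_induction_on generalizing x with
    | _ n ih =>
      by_cases hxy : x = y
      · exact hxy.le
      · obtain ⟨c, hc, h₁, h₂⟩ := exists_arrow hxy hl hr
        have := pos_lt_of_arrow hc
        exact Relation.ReflTransGen.head hc (ih _ (by omega) h₁ h₂ rfl)

theorem pos_mono {x y : AffWt} (h : x ≤ y) : x.pos ≤ y.pos := by
  change Relation.ReflTransGen Arrow x y at h
  induction h with
  | refl => exact le_rfl
  | tail _ h ih =>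
    have := pos_lt_of_arrow h
    omega

theorem pos_strictMono {x y : AffWt} (h : x < y) : x.pos < y.pos :=
  (pos_mono h.le).lt_of_ne fun h' => h.ne (pos_injective h')

theorem exists_arrow_le {x y : AffWt} (h : x < y) : ∃ c, Arrow x c ∧ c ≤ y := by
  obtain ⟨c, hc, h'⟩ := exists_arrow h.ne (le_iff.1 h.le).1 (le_iff.1 h.le).2
  exact ⟨c, hc, le_iff.2 h'⟩

theorem lt_of_arrow {x y : AffWt} (h : Arrow x y) : x < y :=
  lt_of_le_of_ne (Relation.ReflTransGen.single h) fun e => by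
    have := ht_arrow h
    rw [e] at this
    omega

end AffWt

/-! ## Root operators -/

/-- The simple roots of the affine root system of type `D₅`. -/
inductive SimpleRoot : Type
  | r0 | r1 | r2 | r3 | r4 | r5

namespace SimpleRoot

/-- The arrows `α^r → β^(r+k)` labelled by a simple root; the value is `(β, k, ε)`, where `ε` is
the matrix entry of the root vector. -/
def arrow : SimpleRoot → SpinWt → Option (SpinWt × ℤ × ℤ)
  | r1, .w13 => some (.w23, 0, 1) | r1, .w14 => some (.w24, 0, 1)
  | r1, .w15 => some (.w25, 0, 1) | r1, .p2 => some (.p1, 0, 1)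
  | r2, .w12 => some (.w13, 0, 1) | r2, .w24 => some (.w34, 0, 1)
  | r2, .w25 => some (.w35, 0, 1) | r2, .p3 => some (.p2, 0, 1)
  | r3, .w13 => some (.w14, 0, 1) | r3, .w23 => some (.w24, 0, 1)
  | r3, .w35 => some (.w45, 0, 1) | r3, .p4 => some (.p3, 0, 1)
  | r4, .w14 => some (.w15, 0, 1) | r4, .w24 => some (.w25, 0, 1)
  | r4, .w34 => some (.w35, 0, 1) | r4, .p5 => some (.p4, 0, 1)
  | r5, .w0 => some (.w12, 0, 1) | r5, .w34 => some (.p5, 0, -1)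
  | r5, .w35 => some (.p4, 0, -1) | r5, .w45 => some (.p3, 0, -1)
  | r0, .w45 => some (.w0, 1, 1) | r0, .p3 => some (.w12, 1, -1)
  | r0, .p2 => some (.w13, 1, -1) | r0, .p1 => some (.w23, 1, -1)
  | _, _ => none

theorem arrow_spec {i : SimpleRoot} {α β : SpinWt} {k ε : ℤ} (h : i.arrow α = some (β, k, ε))
    (r : ℤ) : AffWt.Arrow ⟨α, r⟩ ⟨β, r + k⟩ := by
  cases i <;> cases α <;> simp only [arrow, Option.some.injEq, Prod.mk.injEq, reduceCtorEq] at h <;>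
    obtain ⟨rfl, rfl, rfl⟩ := h <;> simp [AffWt.Arrow, SpinWt.arrows, SpinWt.loopArrows]

theorem exists_arrow {x y : AffWt} (h : AffWt.Arrow x y) :
    ∃ (i : SimpleRoot) (k ε : ℤ), i.arrow x.wt = some (y.wt, k, ε) ∧ y.lvl = x.lvl + k ∧
      ε * ε = 1 := by
  obtain ⟨a, r⟩ := x
  obtain ⟨b, q⟩ := y
  suffices ∃ (i : SimpleRoot) (ε : ℤ), i.arrow a = some (b, q - r, ε) ∧ ε * ε = 1 by
    obtain ⟨i, ε, h⟩ := this
    exact ⟨i, q - r, ε, h.1, by simp, h.2⟩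
  simp only [AffWt.Arrow, SpinWt.arrows, SpinWt.loopArrows, List.mem_cons, Prod.mk.injEq,
    List.not_mem_nil, or_false] at h
  rcases h with ⟨rfl, h⟩ | ⟨rfl, h⟩ <;> casesm* _ ∨ _ <;> obtain ⟨rfl, rfl⟩ := h <;>
    simp only [sub_self, add_sub_cancel_left]
  all_goals first
    | exact ⟨r0, 1, rfl, rfl⟩ | exact ⟨r0, -1, rfl, rfl⟩ | exact ⟨r1, 1, rfl, rfl⟩
    | exact ⟨r2, 1, rfl, rfl⟩ | exact ⟨r3, 1, rfl, rfl⟩ | exact ⟨r4, 1, rfl, rfl⟩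
    | exact ⟨r5, 1, rfl, rfl⟩ | exact ⟨r5, -1, rfl, rfl⟩

/-- The lifting property of the order on `Ê` with respect to a simple root. -/
theorem lift {i : SimpleRoot} {α β γ δ : SpinWt} {k ε k' ε' : ℤ}
    (h : i.arrow α = some (β, k, ε)) (h' : i.arrow γ = some (δ, k', ε')) {r q : ℤ}
    (hle : (⟨β, r + k⟩ : AffWt) ≤ ⟨δ, q + k'⟩) : (⟨α, r⟩ : AffWt) ≤ ⟨γ, q⟩ := by
  rw [AffWt.le_iff] at hle ⊢
  cases i <;> cases α <;> simp only [arrow, Option.some.injEq, Prod.mk.injEq, reduceCtorEq] at h <;>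
    obtain ⟨rfl, rfl, rfl⟩ := h <;> cases γ <;>
    simp only [arrow, Option.some.injEq, Prod.mk.injEq, reduceCtorEq] at h' <;>
    obtain ⟨rfl, rfl, rfl⟩ := h' <;>
    simp only [AffWt.leftPos, AffWt.rightPos, SpinWt.leftPos, SpinWt.rightPos] at * <;> omega

open LaurentPolynomial in
/-- The action on Laurent spinors of the one-parameter unipotent group of a simple root. -/
noncomputable def act {R : Type*} [CommRing R] (i : SimpleRoot) (t : R)
    (lam : SpinWt → LaurentPolynomial R) (α : SpinWt) : LaurentPolynomial R :=
  match i.arrow α with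
  | none => lam α
  | some (β, k, ε) => lam α + C (ε * t) * T (-k) * lam β

open LaurentPolynomial in
theorem pureSpinorQuadric_act {R : Type*} [CommRing R] (i : SimpleRoot) (t : R)
    (lam : SpinWt → LaurentPolynomial R) (h : ∀ s, pureSpinorQuadric lam s = 0) (s : VecWt) :
    pureSpinorQuadric (i.act t lam) s = 0 := by
  have h₁ := h .v1
  have h₂ := h .v2
  have h₃ := h .v3
  have h₄ := h .v4
  have h₅ := h .v5
  have g₁ := h .u1
  have g₂ := h .u2
  have g₃ := h .u3
  have g₄ := h .u4
  have g₅ := h .u5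
  simp only [pureSpinorQuadric] at h₁ h₂ h₃ h₄ h₅ g₁ g₂ g₃ g₄ g₅
  have hs := h s
  clear h
  cases i <;> cases s <;> simp only [pureSpinorQuadric, act, arrow, Int.cast_one, Int.cast_neg,
    one_mul, neg_mul, map_neg] at hs ⊢
  case r0.u4 => linear_combination g₄ + C t * T (-1) * h₅
  case r0.u5 => linear_combination g₅ - C t * T (-1) * h₄
  case r1.v2 => linear_combination h₂ - C t * T (-0) * h₁
  case r1.u1 => linear_combination g₁ + C t * T (-0) * g₂
  case r2.v3 => linear_combination h₃ - C t * T (-0) * h₂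
  case r2.u2 => linear_combination g₂ + C t * T (-0) * g₃
  case r3.v4 => linear_combination h₄ - C t * T (-0) * h₃
  case r3.u3 => linear_combination g₃ + C t * T (-0) * g₄
  case r4.v5 => linear_combination h₅ - C t * T (-0) * h₄
  case r4.u4 => linear_combination g₄ + C t * T (-0) * g₅
  case r5.v1 => linear_combination h₁ - C t * T (-0) * g₂
  case r5.v2 => linear_combination h₂ + C t * T (-0) * g₁
  all_goals linear_combination hs

end SimpleRoot

section KoszulFiltration

variable {k : Type*} {A : Type u} {Λ : Type u} [Field k] [CommRing A] [Algebra k A]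

/-- A Koszul filtration: a family `F` of sets of generators `x ω`, such that the colon ideals of
the initial segments of a member of `F` are generated by members of `F`. -/
def IsKoszulFiltration [LinearOrder Λ] (x : Λ → A) (F : Set (Set Λ)) : Prop :=
  ∀ Ω ∈ F, ∀ ω ∈ Ω, ∃ Ω' ∈ F, ∀ u : A,
    u * x ω ∈ Ideal.span (x '' (Ω ∩ Set.Iio ω)) ↔ u ∈ Ideal.span (x '' Ω')

theorem exists_coeff_of_mem_span [Fintype Λ] {x : Λ → A} {Ω : Set Λ} {y : A}
    (hy : y ∈ Ideal.span (x '' Ω)) :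
    ∃ c : Λ → A, (∀ ω ∉ Ω, c ω = 0) ∧ y = ∑ ω, c ω * x ω := by
  rw [Ideal.span, Finsupp.mem_span_image_iff_linearCombination] at hy
  obtain ⟨l, hl, rfl⟩ := hy
  refine ⟨l, fun ω hω => ?_, ?_⟩
  · by_contra h
    exact hω (hl (Finsupp.mem_support_iff.2 h))
  · rw [Finsupp.linearCombination_apply, Finsupp.sum_fintype _ _ (by simp)]
    rfl

theorem exists_homogeneous_coeff_of_mem_span [Fintype Λ] (𝒜 : ℕ → Submodule k A)
    [GradedAlgebra 𝒜] {x : Λ → A} (hx : ∀ ω, x ω ∈ 𝒜 1) {n : ℕ} {Ω : Set Λ} {y : A}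
    (hy : y ∈ Ideal.span (x '' Ω)) (hy' : y ∈ 𝒜 (n + 1)) :
    ∃ c : Λ → A, (∀ ω, c ω ∈ 𝒜 n) ∧ (∀ ω ∉ Ω, c ω = 0) ∧ y = ∑ ω, c ω * x ω := by
  obtain ⟨c, hc, rfl⟩ := exists_coeff_of_mem_span hy
  refine ⟨fun ω => DirectSum.decompose 𝒜 (c ω) n, fun ω => SetLike.coe_mem _,
    fun ω hω => by simp [hc ω hω], ?_⟩
  rw [← DirectSum.decompose_of_mem_same 𝒜 hy', DirectSum.decompose_sum, DFinsupp.finsetSum_apply,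
    AddSubmonoidClass.coe_finsetSum]
  exact Finset.sum_congr rfl fun ω _ => DirectSum.coe_decompose_mul_add_of_right_mem 𝒜 (hx ω)

variable (𝒜 : ℕ → Submodule k A) (x : Λ → A) (F : Set (Set Λ))

/-- A finite free module with an ordered basis and a submodule generated by vectors with linear
entries whose leading entries run through members of the filtration. -/
structure LinearStage where
  /-- the basis -/
  ι : Type u
  [ord : LinearOrder ι]
  [fin : Finite ι]
  /-- the generators of the leading ideals -/
  allowed : ι → Set Λ
  good : ∀ j, allowed j ∈ F
  /-- the submodule -/
  K : Submodule A (ι →₀ A)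
  exists_lift : ∀ j, ∀ ω ∈ allowed j, ∃ v ∈ K, v j = x ω ∧ (∀ i, j < i → v i = 0) ∧ ∀ i, v i ∈ 𝒜 1
  lead : ∀ v ∈ K, ∀ j, (∀ i, j < i → v i = 0) → v j ∈ Ideal.span (x '' allowed j)

namespace LinearStage

variable {𝒜 x F} (S : LinearStage 𝒜 x F)

instance : LinearOrder S.ι := S.ord

instance : Finite S.ι := S.fin

/-- The index set of the generators of `K`. -/
abbrev Gen : Type u := Σ j : S.ι, S.allowed j

/-- The generator of `K` with a given leading entry. -/
noncomputable def gen (p : S.Gen) : S.ι →₀ A := (S.exists_lift p.1 p.2 p.2.2).choose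

theorem gen_spec (p : S.Gen) : S.gen p ∈ S.K ∧ S.gen p p.1 = x p.2 ∧
    (∀ i, p.1 < i → S.gen p i = 0) ∧ ∀ i, S.gen p i ∈ 𝒜 1 :=
  (S.exists_lift p.1 p.2 p.2.2).choose_spec

/-- The free cover of `K`. -/
noncomputable def d : (S.Gen →₀ A) →ₗ[A] (S.ι →₀ A) := Finsupp.linearCombination A S.gen

theorem d_single (p : S.Gen) (a : A) : S.d (Finsupp.single p a) = a • S.gen p := by
  simp [d]

theorem d_mem (c : S.Gen →₀ A) : S.d c ∈ S.K := by
  rw [d, Finsupp.linearCombination_apply]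
  exact Submodule.sum_mem _ fun p _ => S.K.smul_mem _ (S.gen_spec p).1

theorem d_apply [Fintype S.Gen] (c : S.Gen →₀ A) (i : S.ι) :
    S.d c i = ∑ p, c p * S.gen p i := by
  rw [d, Finsupp.linearCombination_apply, Finsupp.sum_fintype _ _ (by simp),
    Finsupp.finsetSum_apply]
  rfl

theorem eq_zero_or_exists_max (v : S.ι →₀ A) : v = 0 ∨ ∃ j, v j ≠ 0 ∧ ∀ i, j < i → v i = 0 := by
  by_cases h : v = 0
  · exact Or.inl h
  · have hne : v.support.Nonempty := Finsupp.support_nonempty_iff.2 h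
    refine Or.inr ⟨v.support.max' hne, Finsupp.mem_support_iff.1 (v.support.max'_mem hne),
      fun i hi => ?_⟩
    by_contra hne'
    exact (v.support.le_max' i (Finsupp.mem_support_iff.2 hne')).not_gt hi

section Row

variable [Finite Λ]

open Classical in
/-- The element of the free cover supported over `j` with coefficients `c`. -/
noncomputable def row (j : S.ι) (c : Λ → A) : S.Gen →₀ A :=
  Finsupp.equivFunOnFinite.symm fun p => if p.1 = j then c p.2 else 0

theorem row_apply_self (j : S.ι) (c : Λ → A) (ω : S.allowed j) : S.row j c ⟨j, ω⟩ = c ω := by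
  simp [row]

theorem row_apply_of_ne {j : S.ι} (c : Λ → A) {p : S.Gen} (hp : p.1 ≠ j) : S.row j c p = 0 := by
  simp [row, hp]

theorem row_mem {M : Submodule k A} {j : S.ι} {c : Λ → A} (hc : ∀ ω, c ω ∈ M) (p : S.Gen) :
    S.row j c p ∈ M := by
  by_cases hp : p.1 = j
  · simpa [row, hp] using hc _
  · rw [S.row_apply_of_ne c hp]
    exact M.zero_mem

theorem d_row_apply [∀ j, Fintype (S.allowed j)] (j : S.ι) (c : Λ → A) (i : S.ι) :
    S.d (S.row j c) i = ∑ ω : S.allowed j, c ω * S.gen ⟨j, ω⟩ i := by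
  classical
  have := Fintype.ofFinite S.ι
  rw [S.d_apply, Fintype.sum_sigma, Finset.sum_eq_single j]
  · exact Finset.sum_congr rfl fun ω _ => by rw [S.row_apply_self]
  · intro b _ hb
    exact Finset.sum_eq_zero fun ω _ => by rw [S.row_apply_of_ne c hb, zero_mul]
  · simp

theorem d_row_apply_of_lt {j i : S.ι} (c : Λ → A) (hi : j < i) : S.d (S.row j c) i = 0 := by
  have this (j) : Fintype (S.allowed j) := Fintype.ofFinite _
  rw [S.d_row_apply]
  exact Finset.sum_eq_zero fun ω _ => by rw [(S.gen_spec ⟨j, ω⟩).2.2.1 i hi, mul_zero]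

theorem d_row_mem {M M' : Submodule k A} (hmul : ∀ a ∈ M, ∀ b ∈ 𝒜 1, a * b ∈ M') {j : S.ι}
    {c : Λ → A} (hc : ∀ ω, c ω ∈ M) (i : S.ι) : S.d (S.row j c) i ∈ M' := by
  have this (j) : Fintype (S.allowed j) := Fintype.ofFinite _
  rw [S.d_row_apply]
  exact Submodule.sum_mem _ fun ω _ => hmul _ (hc _) _ ((S.gen_spec _).2.2.2 i)

end Row

theorem d_row_apply_self [Fintype Λ] {j : S.ι} {c : Λ → A} (hc : ∀ ω ∉ S.allowed j, c ω = 0) :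
    S.d (S.row j c) j = ∑ ω, c ω * x ω := by
  classical
  have this (j) : Fintype (S.allowed j) := Fintype.ofFinite _
  rw [S.d_row_apply, ← Finset.sum_filter_of_ne (p := (· ∈ S.allowed j))
    (fun ω _ hne => by_contra fun h => hne (by rw [hc ω h, zero_mul])),
    Finset.sum_subtype (p := (· ∈ S.allowed j)) _ (by simp)]
  exact Fintype.sum_equiv (Equiv.refl _) _ _ fun ω => by
    rw [(S.gen_spec ⟨j, ω⟩).2.1]; rfl

theorem exists_d_eq [Fintype Λ] {M M' : Submodule k A}
    (hM : ∀ (Ω : Set Λ) (y : A), y ∈ Ideal.span (x '' Ω) → y ∈ M' →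
      ∃ c : Λ → A, (∀ ω, c ω ∈ M) ∧ (∀ ω ∉ Ω, c ω = 0) ∧ y = ∑ ω, c ω * x ω)
    (hmul : ∀ a ∈ M, ∀ b ∈ 𝒜 1, a * b ∈ M') {v : S.ι →₀ A} (hv : v ∈ S.K) (hv' : ∀ i, v i ∈ M') :
    ∃ c : S.Gen →₀ A, (∀ p, c p ∈ M) ∧ (∀ p, (∀ i, p.1 ≤ i → v i = 0) → c p = 0) ∧ S.d c = v := by
  rcases S.eq_zero_or_exists_max v with rfl | ⟨j, hj, hj0⟩
  · exact ⟨0, by simp, by simp, by simp⟩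
  induction j using WellFoundedLT.induction generalizing v with
  | _ j ih =>
  obtain ⟨c, hc, hc0, hcv⟩ := hM _ _ (S.lead v hv j hj0) (hv' j)
  have hne {p : S.Gen} (hp : ∀ i, p.1 ≤ i → v i = 0) : p.1 ≠ j := fun h => hj (hp j h.le)
  have hw0 (i) (hi : j ≤ i) : (v - S.d (S.row j c)) i = 0 := by
    rw [Finsupp.sub_apply]
    rcases hi.eq_or_lt with rfl | hi
    · rw [S.d_row_apply_self hc0, hcv, sub_self]
    · rw [S.d_row_apply_of_lt c hi, hj0 i hi, sub_self]
  rcases S.eq_zero_or_exists_max (v - S.d (S.row j c)) with h | ⟨j', hj', hj0'⟩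
  · exact ⟨S.row j c, S.row_mem hc, fun p hp => S.row_apply_of_ne c (hne hp),
      (sub_eq_zero.1 h).symm⟩
  · have hlt : j' < j := not_le.1 fun h => hj' (hw0 _ h)
    obtain ⟨c', hc', hc0', hcd⟩ := ih j' hlt (S.K.sub_mem hv (S.d_mem _))
      (fun i => M'.sub_mem (hv' i) (S.d_row_mem hmul hc i)) hj' hj0'
    refine ⟨S.row j c + c', fun p => M.add_mem (S.row_mem hc p) (hc' p), fun p hp => ?_, ?_⟩
    · have hp' : j < p.1 := not_le.1 fun h => hj (hp j h)
      rw [Finsupp.add_apply, S.row_apply_of_ne c (hne hp),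
        hc0' p fun i hi => hw0 i (hp'.le.trans hi), add_zero]
    · rw [map_add, hcd, add_sub_cancel]

theorem range_d [Finite Λ] : LinearMap.range S.d = S.K := by
  have := Fintype.ofFinite Λ
  refine le_antisymm ?_ fun v hv => ?_
  · rintro _ ⟨c, rfl⟩
    exact S.d_mem c
  · obtain ⟨c, -, -, hc⟩ := S.exists_d_eq (M := ⊤) (M' := ⊤)
      (fun Ω y hy _ => by
        obtain ⟨c, hc⟩ := exists_coeff_of_mem_span hy
        exact ⟨c, fun _ => trivial, hc⟩)
      (fun _ _ _ _ => trivial) hv fun _ => trivial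
    exact ⟨c, hc⟩

theorem mem_K_iff [Finite Λ] (v : S.ι →₀ A) : v ∈ S.K ↔ v ∈ Set.range S.d := by
  rw [← S.range_d]
  rfl

variable [LinearOrder Λ]

theorem toLex_lt_iff (p q : S.Gen) :
    toLex p < toLex q ↔ p.1 < q.1 ∨ p.1 = q.1 ∧ (p.2 : Λ) < q.2 := by
  obtain ⟨j, ω⟩ := p
  obtain ⟨j', ω'⟩ := q
  rw [Sigma.Lex.lt_def]
  constructor
  · rintro (h | ⟨h, h'⟩)
    · exact Or.inl h
    · change j = j' at h
      subst h
      exact Or.inr ⟨rfl, h'⟩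
  · rintro (h | ⟨h, h'⟩)
    · exact Or.inl h
    · change j = j' at h
      subst h
      exact Or.inr ⟨rfl, h'⟩

theorem mul_mem_of_mem_ker [Finite Λ] {u : S.Gen →₀ A} (hker : u ∈ LinearMap.ker S.d) {p : S.Gen}
    (hu : ∀ q : S.Gen, toLex p < toLex q → u q = 0) :
    u p * x p.2 ∈ Ideal.span (x '' (S.allowed p.1 ∩ Set.Iio (p.2 : Λ))) := by
  classical
  have := Fintype.ofFinite S.Gen
  have h := S.d_apply u p.1
  rw [LinearMap.mem_ker.1 hker, ← Finset.add_sum_erase _ _ (Finset.mem_univ p),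
    (S.gen_spec p).2.1, Finsupp.zero_apply, eq_comm, add_eq_zero_iff_eq_neg] at h
  rw [h, Ideal.neg_mem_iff]
  refine Ideal.sum_mem _ fun q hq => ?_
  have hqp : q ≠ p := Finset.ne_of_mem_erase hq
  rcases lt_trichotomy (toLex p) (toLex q) with h | h | h
  · simp [hu q h]
  · exact absurd (toLex.injective h).symm hqp
  · rcases (S.toLex_lt_iff _ _).1 h with h | ⟨h, h'⟩
    · simp [(S.gen_spec q).2.2.1 _ h]
    · obtain ⟨j, ω⟩ := p
      obtain ⟨j', ω'⟩ := q
      change j' = j at h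
      subst h
      rw [(S.gen_spec ⟨j', ω'⟩).2.1]
      exact Ideal.mul_mem_left _ _ (Ideal.subset_span ⟨ω', ⟨ω'.2, h'⟩, rfl⟩)

variable [Finite Λ] [GradedAlgebra 𝒜]

theorem exists_lift_ker (hx : ∀ ω, x ω ∈ 𝒜 1) (p : S.Gen) {τ : Λ}
    (hτ : x τ * x p.2 ∈ Ideal.span (x '' (S.allowed p.1 ∩ Set.Iio (p.2 : Λ)))) :
    ∃ v ∈ LinearMap.ker S.d, v p = x τ ∧ (∀ q, toLex p < toLex q → v q = 0) ∧ ∀ q, v q ∈ 𝒜 1 := by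
  classical
  have := Fintype.ofFinite Λ
  obtain ⟨j, ω⟩ := p
  obtain ⟨c, hc, hc0, hcx⟩ := exists_homogeneous_coeff_of_mem_span 𝒜 hx hτ
    (SetLike.mul_mem_graded (hx τ) (hx ω))
  set c₁ : Λ → A := Pi.single (ω : Λ) (x τ) - c with hc₁
  have hcω : c ω = 0 := hc0 _ fun h => lt_irrefl _ h.2
  have hc₁1 (ω') : c₁ ω' ∈ 𝒜 1 := by
    rw [hc₁, Pi.sub_apply]
    refine (𝒜 1).sub_mem ?_ (hc _)
    rw [Pi.single_apply]
    split_ifs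
    exacts [hx τ, (𝒜 1).zero_mem]
  have hc₁0 (ω') (h : ω' ∉ S.allowed j) : c₁ ω' = 0 := by
    have hne : ω' ≠ ω := by
      rintro rfl
      exact h ω.2
    rw [hc₁, Pi.sub_apply, Pi.single_eq_of_ne hne, hc0 ω' fun h' => h h'.1, sub_zero]
  have hmul (a) (ha : a ∈ 𝒜 1) (b) (hb : b ∈ 𝒜 1) : a * b ∈ 𝒜 2 := SetLike.mul_mem_graded ha hb
  have hd (i) (hi : j ≤ i) : S.d (S.row j c₁) i = 0 := by
    rcases hi.eq_or_lt with rfl | hi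
    · rw [S.d_row_apply_self hc₁0]
      simp only [hc₁, Pi.sub_apply, sub_mul, Finset.sum_sub_distrib]
      rw [← hcx, Finset.sum_eq_single (ω : Λ) (fun b _ hb => by simp [hb]) (by simp)]
      simp
    · exact S.d_row_apply_of_lt _ hi
  obtain ⟨c', hc', hc0', hcd⟩ := S.exists_d_eq (M := 𝒜 1) (M' := 𝒜 2)
    (fun Ω y hy hy' => exists_homogeneous_coeff_of_mem_span 𝒜 hx hy hy') hmul
    (S.d_mem (S.row j c₁)) (S.d_row_mem hmul hc₁1)
  refine ⟨S.row j c₁ - c', by simp [hcd], ?_, fun q hq => ?_, fun q => ?_⟩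
  · rw [Finsupp.sub_apply, S.row_apply_self, hc0' ⟨j, ω⟩ hd]
    simp [hc₁, hcω]
  · rcases (S.toLex_lt_iff _ _).1 hq with h | ⟨h, h'⟩
    · rw [Finsupp.sub_apply, S.row_apply_of_ne _ h.ne', hc0' q fun i hi => hd i (h.le.trans hi),
        sub_zero]
    · obtain ⟨j', ω'⟩ := q
      change j = j' at h
      subst h
      change (ω : Λ) < ω' at h'
      rw [Finsupp.sub_apply, S.row_apply_self, hc0' _ hd]
      simp [hc₁, h'.ne', hc0 ω' fun h => h.2.not_gt h']
  · exact (𝒜 1).sub_mem (S.row_mem hc₁1 q) (hc' q)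

/-- The stage formed by the syzygies of the generators of `K`. -/
noncomputable def next (hx : ∀ ω, x ω ∈ 𝒜 1) (hF : IsKoszulFiltration x F) :
    LinearStage 𝒜 x F where
  ι := Σₗ j : S.ι, S.allowed j
  fin := inferInstanceAs (Finite S.Gen)
  allowed p := (hF _ (S.good (ofLex p).1) _ (ofLex p).2.2).choose
  good p := (hF _ (S.good (ofLex p).1) _ (ofLex p).2.2).choose_spec.1
  K := LinearMap.ker S.d
  exists_lift p τ hτ := S.exists_lift_ker hx p
    (((hF _ (S.good (ofLex p).1) _ (ofLex p).2.2).choose_spec.2 _).2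
      (Ideal.subset_span ⟨τ, hτ, rfl⟩))
  lead _ hv p hp := ((hF _ (S.good (ofLex p).1) _ (ofLex p).2.2).choose_spec.2 _).1
    (S.mul_mem_of_mem_ker (p := ofLex p) hv hp)

variable (𝒜 x F) in
/-- The stage given by the ideal of all generators in the free module of rank one. -/
noncomputable def init (hx : ∀ ω, x ω ∈ 𝒜 1) (huniv : Set.univ ∈ F) : LinearStage 𝒜 x F where
  ι := PUnit
  allowed _ := Set.univ
  good _ := huniv
  K := Submodule.comap (Finsupp.lapply PUnit.unit) (Ideal.span (Set.range x))
  exists_lift j ω _ := ⟨Finsupp.single PUnit.unit (x ω),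
    by simpa using Ideal.subset_span (Set.mem_range_self ω),
    by simp, fun i hi => absurd hi (lt_irrefl _), fun i => by simpa using hx ω⟩
  lead v hv j _ := by simpa using hv

/-- The successive syzygies of the trivial module. -/
noncomputable def syzygy (hx : ∀ ω, x ω ∈ 𝒜 1) (hF : IsKoszulFiltration x F)
    (huniv : Set.univ ∈ F) : ℕ → LinearStage 𝒜 x F
  | 0 => init 𝒜 x F hx huniv
  | n + 1 => (syzygy hx hF huniv n).next hx hF

end LinearStage

/-- A graded algebra with a Koszul filtration is Koszul. -/
theorem IsKoszulFiltration.isKoszul [LinearOrder Λ] [Finite Λ] [Nontrivial A] [GradedAlgebra 𝒜]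
    {x : Λ → A} {F : Set (Set Λ)} (hF : IsKoszulFiltration x F) (hx : ∀ ω, x ω ∈ 𝒜 1)
    (huniv : Set.univ ∈ F) (h0 : 𝒜 0 = 1)
    (hpos : positiveIdeal 𝒜 = Ideal.span (Set.range x)) : IsKoszul 𝒜 where
  graded := inferInstance
  internal := DirectSum.Decomposition.isInternal 𝒜
  nontrivial := inferInstance
  connected := h0
  linear := by
    let S := LinearStage.syzygy (𝒜 := 𝒜) hx hF huniv
    let ε : (PUnit →₀ A) →ₗ[A] A ⧸ positiveIdeal 𝒜 :=
      (Ideal.Quotient.mkₐ A (positiveIdeal 𝒜)).toLinearMap ∘ₗ Finsupp.lapply PUnit.unit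
    have hε (v : PUnit →₀ A) : ε v = 0 ↔ v ∈ (S 0).K := by
      change Ideal.Quotient.mk (positiveIdeal 𝒜) (v PUnit.unit) = 0 ↔
        v PUnit.unit ∈ Ideal.span (Set.range x)
      rw [Ideal.Quotient.eq_zero_iff_mem, hpos]
    refine ⟨fun n => (S n).ι, fun n => (S n).d, ε, fun n p i => ?_, fun y => ?_,
      fun v => (hε v).trans ((S 0).mem_K_iff v), fun n v => (S (n + 1)).mem_K_iff v⟩
    · have h := (S n).d_single p 1
      rw [one_smul] at h
      exact h ▸ ((S n).gen_spec p).2.2.2 i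
    · obtain ⟨a, rfl⟩ := Ideal.Quotient.mk_surjective y
      exact ⟨Finsupp.single PUnit.unit a,
        congrArg (Ideal.Quotient.mk (positiveIdeal 𝒜)) Finsupp.single_eq_same⟩

end KoszulFiltration

namespace AffWt

theorem lt_iff {x y : AffWt} : x < y ↔ x.leftPos < y.leftPos ∧ x.rightPos < y.rightPos := by
  constructor
  · intro h
    obtain ⟨c, hc, hcy⟩ := exists_arrow_le h
    have h₁ := pos_lt_of_arrow hc
    have h₂ := le_iff.1 hcy
    omega
  · intro h
    refine lt_of_le_of_ne (le_iff.2 ⟨h.1.le, h.2.le⟩) ?_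
    rintro rfl
    exact lt_irrefl _ h.1

end AffWt

/-! ## Terms of the quadrics -/

namespace VecWt

/-- The terms `ε λ^α λ^β` of the quadric `Γ^s`, as triples `(α, β, ε)`. -/
def terms : VecWt → Finset (SpinWt × SpinWt × ℤ)
  | v1 => {(.w0, .p1, 1), (.w25, .w34, 1), (.w24, .w35, -1), (.w23, .w45, 1)}
  | v2 => {(.w0, .p2, -1), (.w15, .w34, -1), (.w14, .w35, 1), (.w13, .w45, -1)}
  | v3 => {(.w0, .p3, 1), (.w15, .w24, 1), (.w14, .w25, -1), (.w12, .w45, 1)}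
  | v4 => {(.w0, .p4, -1), (.w15, .w23, -1), (.w13, .w25, 1), (.w12, .w35, -1)}
  | v5 => {(.w0, .p5, 1), (.w14, .w23, 1), (.w13, .w24, -1), (.w12, .w34, 1)}
  | u1 => {(.p2, .w12, -1), (.p3, .w13, 1), (.p4, .w14, -1), (.p5, .w15, 1)}
  | u2 => {(.p1, .w12, -1), (.p3, .w23, 1), (.p4, .w24, -1), (.p5, .w25, 1)}
  | u3 => {(.p1, .w13, -1), (.p2, .w23, 1), (.p4, .w34, -1), (.p5, .w35, 1)}
  | u4 => {(.p1, .w14, -1), (.p2, .w24, 1), (.p3, .w34, -1), (.p5, .w45, 1)}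
  | u5 => {(.p1, .w15, -1), (.p2, .w25, 1), (.p3, .w35, -1), (.p4, .w45, 1)}

theorem coeff_ne_zero {s : VecWt} {t : SpinWt × SpinWt × ℤ} (ht : t ∈ s.terms) : t.2.2 ≠ 0 := by
  cases s <;> simp only [terms, Finset.mem_insert, Finset.mem_singleton] at ht <;>
    rcases ht with rfl | rfl | rfl | rfl <;> decide

theorem ne_of_mem_terms {s : VecWt} {t : SpinWt × SpinWt × ℤ} (ht : t ∈ s.terms) : t.1 ≠ t.2.1 := by
  cases s <;> simp only [terms, Finset.mem_insert, Finset.mem_singleton] at ht <;>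
    rcases ht with rfl | rfl | rfl | rfl <;> decide

end VecWt

theorem pureSpinorQuadric_eq_sum {R : Type*} [CommRing R] (lam : SpinWt → R) (s : VecWt) :
    pureSpinorQuadric lam s = ∑ t ∈ s.terms, (t.2.2 : R) * (lam t.1 * lam t.2.1) := by
  cases s <;> simp [pureSpinorQuadric, VecWt.terms] <;> ring

namespace AffWt

set_option maxHeartbeats 1000000 in
/-- Two incomparable weights are the factors of a term of some quadric. -/
theorem exists_mem_terms {x y : AffWt} (hxy : ¬ x ≤ y) (hyx : ¬ y ≤ x) :
    ∃ (s : VecWt) (ε : ℤ), (x.wt, y.wt, ε) ∈ s.terms ∨ (y.wt, x.wt, ε) ∈ s.terms := by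
  obtain ⟨a, r⟩ := x
  obtain ⟨b, q⟩ := y
  rw [le_iff] at hxy hyx
  change ∃ (s : VecWt) (ε : ℤ), (a, b, ε) ∈ s.terms ∨ (b, a, ε) ∈ s.terms
  cases a <;> cases b <;> first
      | exfalso
        simp only [leftPos, rightPos, SpinWt.leftPos, SpinWt.rightPos] at hxy hyx
        omega
      | exact ⟨.v1, 1, by decide⟩ | exact ⟨.v1, -1, by decide⟩
      | exact ⟨.v2, 1, by decide⟩ | exact ⟨.v2, -1, by decide⟩
      | exact ⟨.v3, 1, by decide⟩ | exact ⟨.v3, -1, by decide⟩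
      | exact ⟨.v4, 1, by decide⟩ | exact ⟨.v4, -1, by decide⟩
      | exact ⟨.v5, 1, by decide⟩ | exact ⟨.v5, -1, by decide⟩
      | exact ⟨.u1, 1, by decide⟩ | exact ⟨.u1, -1, by decide⟩
      | exact ⟨.u2, 1, by decide⟩ | exact ⟨.u2, -1, by decide⟩
      | exact ⟨.u3, 1, by decide⟩ | exact ⟨.u3, -1, by decide⟩
      | exact ⟨.u4, 1, by decide⟩ | exact ⟨.u4, -1, by decide⟩
      | exact ⟨.u5, 1, by decide⟩ | exact ⟨.u5, -1, by decide⟩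

set_option maxHeartbeats 1000000 in
/-- In a quadric, all terms except the incomparable one have a factor which is smaller than both
factors of the incomparable term. -/
theorem term_straightening {s : VecWt} {t t' : SpinWt × SpinWt × ℤ} (ht : t ∈ s.terms)
    (ht' : t' ∈ s.terms) {r q r' q' : ℤ} (hl : r' + q' = r + q)
    (hxy : ¬ (⟨t.1, r⟩ : AffWt) ≤ ⟨t.2.1, q⟩) (hyx : ¬ (⟨t.2.1, q⟩ : AffWt) ≤ ⟨t.1, r⟩) :
    (t' = t ∧ r' = r ∧ q' = q) ∨
      ((⟨t'.1, r'⟩ : AffWt) < ⟨t.1, r⟩ ∧ (⟨t'.1, r'⟩ : AffWt) < ⟨t.2.1, q⟩) ∨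
      ((⟨t'.2.1, q'⟩ : AffWt) < ⟨t.1, r⟩ ∧ (⟨t'.2.1, q'⟩ : AffWt) < ⟨t.2.1, q⟩) := by
  simp only [le_iff, lt_iff] at *
  cases s <;> simp only [VecWt.terms, Finset.mem_insert, Finset.mem_singleton] at ht ht' <;>
    rcases ht with rfl | rfl | rfl | rfl <;> rcases ht' with rfl | rfl | rfl | rfl <;>
    simp only [leftPos, rightPos, SpinWt.leftPos, SpinWt.rightPos, true_and, Prod.mk.injEq,
      reduceCtorEq, false_and, false_or] at * <;> omega

end AffWt

open LaurentPolynomial in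
theorem LaurentPolynomial.coeff_intCast_mul {R : Type*} [CommRing R] (e : ℤ)
    (f : LaurentPolynomial R) (l : ℤ) : ((e : LaurentPolynomial R) * f).coeff l = e * f.coeff l := by
  have h : (e : LaurentPolynomial R) = C (e : R) := by simp
  rw [h, ← smul_eq_C_mul, AddMonoidAlgebra.coeff_smul, Finsupp.smul_apply, smul_eq_mul]

open LaurentPolynomial in
theorem LaurentPolynomial.coeff_C_mul_T_mul {R : Type*} [CommRing R] (a : R) (k : ℤ)
    (f : LaurentPolynomial R) (l : ℤ) : (C a * T k * f).coeff l = a * f.coeff (l - k) := by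
  rw [← single_eq_C_mul_T, AddMonoidAlgebra.coeff_single_mul_apply, sub_eq_add_neg, add_comm]

open LaurentPolynomial in
theorem LaurentPolynomial.coeff_C_mul_T {R : Type*} [CommRing R] (a : R) (k l : ℤ) :
    (C a * T k).coeff l = if k = l then a else 0 := by
  rw [← single_eq_C_mul_T, AddMonoidAlgebra.coeff_single, Finsupp.single_apply]

namespace AffWt

variable (δ δ' : AffWt)

/-- The pairs of weights in `[δ, δ']` contributing to the coefficient of `z^l` in `Γ^s`, together
with the term of `Γ^s` they belong to. -/
noncomputable def termPairs (s : VecWt) (l : ℤ) :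
    Finset ((SpinWt × SpinWt × ℤ) × Set.Icc δ δ' × Set.Icc δ δ') :=
  (s.terms ×ˢ Finset.univ).filter fun p => p.2.1.1.wt = p.1.1 ∧ p.2.2.1.wt = p.1.2.1 ∧
    p.2.1.1.lvl + p.2.2.1.lvl = l

theorem quadric_eq_sum (s : VecWt) (l : ℤ) :
    quadric δ δ' s l = ∑ p ∈ termPairs δ δ' s l,
      MvPolynomial.C (p.1.2.2 : ℂ) * (MvPolynomial.X p.2.1 * MvPolynomial.X p.2.2) := by
  classical
  rw [quadric, pureSpinorQuadric_eq_sum, AddMonoidAlgebra.coeff_sum, Finsupp.finsetSum_apply,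
    termPairs, Finset.sum_filter, Finset.sum_product]
  refine Finset.sum_congr rfl fun t _ => ?_
  rw [LaurentPolynomial.coeff_intCast_mul, genFun, genFun, Finset.sum_mul_sum,
    AddMonoidAlgebra.coeff_sum, Finsupp.finsetSum_apply, Fintype.sum_prod_type, Finset.sum_filter,
    Finset.mul_sum]
  refine Finset.sum_congr rfl fun x _ => ?_
  rw [AddMonoidAlgebra.coeff_sum, Finsupp.finsetSum_apply, Finset.sum_filter]
  by_cases hx : x.1.wt = t.1
  · rw [if_pos hx, Finset.mul_sum]
    refine Finset.sum_congr rfl fun y _ => ?_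
    by_cases hy : y.1.wt = t.2.1
    · rw [if_pos hy, mul_assoc, LaurentPolynomial.T_mul, mul_assoc,
        ← LaurentPolynomial.T_add, ← mul_assoc, ← map_mul, LaurentPolynomial.coeff_C_mul_T]
      by_cases hl : x.1.lvl + y.1.lvl = l
      · rw [if_pos (by rw [add_comm, hl]), if_pos ⟨hx, hy, hl⟩]
        simp
      · rw [if_neg (by rwa [add_comm]), if_neg fun h => hl h.2.2, mul_zero]
    · rw [if_neg hy, if_neg fun h => hy h.2.1, mul_zero]
  · rw [if_neg hx, mul_zero]
    exact (Finset.sum_eq_zero fun y _ => if_neg fun h => hx h.1).symm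

theorem quadric_isHomogeneous (s : VecWt) (l : ℤ) : (quadric δ δ' s l).IsHomogeneous 2 := by
  rw [quadric_eq_sum]
  refine MvPolynomial.IsHomogeneous.sum _ _ _ fun p _ => ?_
  have h := (MvPolynomial.isHomogeneous_C (Set.Icc δ δ') (p.1.2.2 : ℂ)).mul
    ((MvPolynomial.isHomogeneous_X ℂ p.2.1).mul (MvPolynomial.isHomogeneous_X ℂ p.2.2))
  exact h

variable {δ δ'}

/-- The monomials of degree two with a factor that is smaller than `a` and `b`. -/
def smallMonomials (a b : Set.Icc δ δ') : Set (Set.Icc δ δ' →₀ ℕ) :=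
  {m | ∃ x y : Set.Icc δ δ', x < a ∧ x < b ∧ m = Finsupp.single x 1 + Finsupp.single y 1}

theorem C_mul_X_mul_X_mem {a b x y : Set.Icc δ δ'} (hx : x < a) (hx' : x < b) (c : ℂ) :
    MvPolynomial.C c * (MvPolynomial.X x * MvPolynomial.X y) ∈
      MvPolynomial.restrictSupport ℂ (smallMonomials a b) := by
  classical
  have h : MvPolynomial.C c * (MvPolynomial.X x * MvPolynomial.X y) =
      MvPolynomial.monomial (Finsupp.single x 1 + Finsupp.single y 1) c := by
    rw [MvPolynomial.X, MvPolynomial.X, MvPolynomial.monomial_mul, MvPolynomial.C_mul_monomial,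
      mul_one, mul_one]
  rw [MvPolynomial.mem_restrictSupport_iff, h]
  refine (Finset.coe_subset.2 MvPolynomial.support_monomial_subset).trans ?_
  simpa using ⟨x, y, hx, hx', rfl⟩

/-- The straightening relations. -/
theorem exists_quadric_sub_mem {a b : Set.Icc δ δ'} (hab : ¬ a ≤ b) (hba : ¬ b ≤ a) :
    ∃ (s : VecWt) (l : ℤ) (ε : ℂ), ε ≠ 0 ∧
      quadric δ δ' s l - MvPolynomial.C ε * (MvPolynomial.X a * MvPolynomial.X b) ∈
        MvPolynomial.restrictSupport ℂ (smallMonomials a b) := by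
  classical
  obtain ⟨s, ε, h⟩ := exists_mem_terms hab hba
  wlog h' : (a.1.wt, b.1.wt, ε) ∈ s.terms generalizing a b
  · obtain ⟨s', l, ε', hε, hq⟩ := this hba hab h.symm (h.resolve_left h')
    refine ⟨s', l, ε', hε, ?_⟩
    have hs : smallMonomials a b = smallMonomials b a := by
      ext m
      exact exists_congr fun x => exists_congr fun y => and_left_comm
    rwa [mul_comm (MvPolynomial.X a), hs]
  refine ⟨s, a.1.lvl + b.1.lvl, ε, Int.cast_ne_zero.2 (VecWt.coeff_ne_zero h'), ?_⟩
  have hmem : ((a.1.wt, b.1.wt, ε), a, b) ∈ termPairs δ δ' s (a.1.lvl + b.1.lvl) := by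
    simp [termPairs, h']
  rw [quadric_eq_sum, ← Finset.add_sum_erase _ _ hmem, add_sub_cancel_left]
  refine Submodule.sum_mem _ fun p hp => ?_
  obtain ⟨hne, hp⟩ := Finset.mem_erase.1 hp
  obtain ⟨t, x, y⟩ := p
  simp only [termPairs, Finset.mem_filter, Finset.mem_product, Finset.mem_univ, and_true] at hp
  obtain ⟨ht, hx, hy, hl⟩ := hp
  have hx' : x.1 = ⟨t.1, x.1.lvl⟩ := AffWt.ext hx rfl
  have hy' : y.1 = ⟨t.2.1, y.1.lvl⟩ := AffWt.ext hy rfl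
  rcases term_straightening h' ht hl hab hba with ⟨rfl, hr, hq⟩ | ⟨h₁, h₂⟩ | ⟨h₁, h₂⟩
  · refine absurd ?_ hne
    exact Prod.ext rfl (Prod.ext (Subtype.ext (AffWt.ext hx hr)) (Subtype.ext (AffWt.ext hy hq)))
  · rw [← hx'] at h₁ h₂
    exact C_mul_X_mul_X_mem h₁ h₂ _
  · rw [← hy'] at h₁ h₂
    rw [mul_comm (MvPolynomial.X x)]
    exact C_mul_X_mul_X_mem h₁ h₂ _

end AffWt

/-! ## Points of the cone of pure spinors over Laurent polynomials -/

namespace AffWt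

section Points

variable {R : Type} [CommRing R]

/-- The coordinate with index `α^r` of a Laurent spinor. -/
noncomputable def coord (lam : SpinWt → LaurentPolynomial R) (x : AffWt) : R :=
  (lam x.wt).coeff x.lvl

/-- A pure Laurent spinor with coordinates supported in `[w, δ']`, with nonzero coordinate at
`w`. -/
structure IsCellPoint (w δ' : AffWt) (lam : SpinWt → LaurentPolynomial R) : Prop where
  quadric : ∀ s, pureSpinorQuadric lam s = 0
  support : ∀ x, coord lam x ≠ 0 → x ∈ Set.Icc w δ'
  ne_zero : coord lam w ≠ 0

theorem coord_act {i : SimpleRoot} {x : AffWt} {β : SpinWt} {k ε : ℤ}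
    (h : i.arrow x.wt = some (β, k, ε)) (t : R) (lam : SpinWt → LaurentPolynomial R) :
    coord (i.act t lam) x = coord lam x + ε * t * coord lam ⟨β, x.lvl + k⟩ := by
  simp only [coord, SimpleRoot.act, h]
  rw [AddMonoidAlgebra.coeff_add, Finsupp.add_apply, LaurentPolynomial.coeff_C_mul_T_mul,
    sub_neg_eq_add]

theorem coord_act_cases (i : SimpleRoot) (t : R) (lam : SpinWt → LaurentPolynomial R)
    (x : AffWt) : coord (i.act t lam) x = coord lam x ∨ ∃ β k ε, i.arrow x.wt = some (β, k, ε) ∧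
      coord (i.act t lam) x = coord lam x + ε * t * coord lam ⟨β, x.lvl + k⟩ := by
  rcases h : i.arrow x.wt with _ | ⟨β, k, ε⟩
  · left
    simp only [coord, SimpleRoot.act, h]
  · exact Or.inr ⟨β, k, ε, rfl, coord_act h t lam⟩

theorem pureSpinorQuadric_map {R S : Type*} [CommRing R] [CommRing S] (f : R →+* S)
    (lam : SpinWt → R) (s : VecWt) :
    pureSpinorQuadric (fun α => f (lam α)) s = f (pureSpinorQuadric lam s) := by
  simp [pureSpinorQuadric_eq_sum]

/-- The one-parameter unipotent group of a simple root moves a point of a cell to a point of any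
adjacent larger cell. -/
theorem IsCellPoint.act [IsDomain R] {w c δ' : AffWt} {lam : SpinWt → LaurentPolynomial R}
    (h : IsCellPoint c δ' lam) (hwc : Arrow w c) :
    ∃ lam' : SpinWt → LaurentPolynomial (Polynomial R), IsCellPoint w δ' lam' ∧
      ∀ x, Polynomial.eval 0 (coord lam' x) = coord lam x := by
  obtain ⟨i, k, ε, hi, hl, hε⟩ := SimpleRoot.exists_arrow hwc
  have hw : w < c := lt_of_arrow hwc
  let lam₀ : SpinWt → LaurentPolynomial (Polynomial R) :=
    fun α => AddMonoidAlgebra.mapRingHom ℤ Polynomial.C (lam α)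
  have hlam₀ (x) : coord lam₀ x = Polynomial.C (coord lam x) :=
    AddMonoidAlgebra.coeff_mapRingHom _ _ _
  have hc : c = ⟨c.wt, w.lvl + k⟩ := AffWt.ext rfl hl
  refine ⟨i.act Polynomial.X lam₀, ⟨fun s => ?_, fun x hx => ?_, ?_⟩, fun x => ?_⟩
  · refine SimpleRoot.pureSpinorQuadric_act _ _ _ (fun s => ?_) s
    rw [pureSpinorQuadric_map, h.quadric, map_zero]
  · have hx₁ (h0 : coord lam x ≠ 0) : x ∈ Set.Icc w δ' :=
      ⟨hw.le.trans (h.support x h0).1, (h.support x h0).2⟩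
    rcases coord_act_cases i Polynomial.X lam₀ x with h' | ⟨β, k', ε', h', h''⟩
    · rw [h', hlam₀] at hx
      exact hx₁ fun h0 => hx (by rw [h0, map_zero])
    · rw [h'', hlam₀, hlam₀] at hx
      by_cases h0 : coord lam x = 0
      · have h1 : coord lam ⟨β, x.lvl + k'⟩ ≠ 0 := fun h1 => hx (by simp [h0, h1])
        have h2 := h.support _ h1
        refine ⟨?_, (lt_of_arrow (SimpleRoot.arrow_spec h' x.lvl)).le.trans h2.2⟩
        rw [hc] at h2
        exact SimpleRoot.lift hi h' h2.1
      · exact hx₁ h0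
  · have hw0 : coord lam w = 0 := by
      by_contra h0
      exact (h.support w h0).1.not_gt hw
    have hε' : (ε : Polynomial R) ≠ 0 := by
      intro h0
      have := congrArg (Int.cast (R := Polynomial R)) hε
      simp [h0] at this
    rw [coord_act hi, hlam₀, hlam₀, hw0, map_zero, zero_add, ← hc]
    exact mul_ne_zero (mul_ne_zero hε' Polynomial.X_ne_zero) (Polynomial.C_ne_zero.2 h.ne_zero)
  · rcases coord_act_cases i Polynomial.X lam₀ x with h' | ⟨β, k', ε', h', h''⟩
    · rw [h', hlam₀, Polynomial.eval_C]
    · rw [h'', hlam₀, hlam₀]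
      simp

theorem exists_isCellPoint {w δ' : AffWt} (h : w ≤ δ') :
    ∃ lam : SpinWt → LaurentPolynomial (Polynomial ℂ), IsCellPoint w δ' lam ∧
      ∀ x, Polynomial.eval 0 (coord lam x) = 0 := by
  classical
  let lam : SpinWt → LaurentPolynomial (Polynomial ℂ) := fun α =>
    if α = w.wt then LaurentPolynomial.C Polynomial.X * LaurentPolynomial.T w.lvl else 0
  have hlam (x) : coord lam x = if x = w then Polynomial.X else 0 := by
    by_cases hx : x.wt = w.wt
    · by_cases hl : w.lvl = x.lvl
      · simp only [coord, lam]
        rw [if_pos hx, LaurentPolynomial.coeff_C_mul_T, if_pos hl,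
          if_pos (AffWt.ext hx hl.symm)]
      · simp only [coord, lam]
        rw [if_pos hx, LaurentPolynomial.coeff_C_mul_T, if_neg hl,
          if_neg fun e => hl (by rw [e])]
    · simp only [coord, lam]
      rw [if_neg hx, if_neg fun e => hx (by rw [e])]
      rfl
  refine ⟨lam, ⟨fun s => ?_, fun x hx => ?_, ?_⟩, fun x => ?_⟩
  · rw [pureSpinorQuadric_eq_sum]
    refine Finset.sum_eq_zero fun t ht => ?_
    have hne := VecWt.ne_of_mem_terms ht
    by_cases h1 : t.1 = w.wt
    · have h2 : lam t.2.1 = 0 := if_neg fun h2 => hne (h1.trans h2.symm)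
      rw [h2, mul_zero, mul_zero]
    · have h2 : lam t.1 = 0 := if_neg h1
      rw [h2, zero_mul, mul_zero]
  · rw [hlam] at hx
    obtain rfl : x = w := by
      by_contra h0
      exact hx (if_neg h0)
    exact ⟨le_rfl, h⟩
  · rw [hlam, if_pos rfl]
    exact Polynomial.X_ne_zero
  · rw [hlam]
    split_ifs <;> simp

end Points

section Vanishing

variable {δ δ' : AffWt}

/-- Evaluation of polynomials at a Laurent spinor. -/
noncomputable def evalAt {R : Type} [CommRing R] [Algebra ℂ R]
    (lam : SpinWt → LaurentPolynomial R) : PolyAlg δ δ' →ₐ[ℂ] R :=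
  MvPolynomial.aeval fun x => coord lam x.1

theorem evalAt_X {R : Type} [CommRing R] [Algebra ℂ R] (lam : SpinWt → LaurentPolynomial R)
    (x : Set.Icc δ δ') : evalAt lam (MvPolynomial.X x : PolyAlg δ δ') = coord lam x.1 :=
  MvPolynomial.aeval_X _ _

theorem map_genFun {R : Type} [CommRing R] [Algebra ℂ R] {lam : SpinWt → LaurentPolynomial R}
    (h : ∀ x, coord lam x ≠ 0 → x ∈ Set.Icc δ δ') (α : SpinWt) :
    AddMonoidAlgebra.mapRingHom ℤ (evalAt lam).toRingHom (genFun δ δ' α) = lam α := by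
  classical
  ext r
  rw [AddMonoidAlgebra.coeff_mapRingHom, genFun, AddMonoidAlgebra.coeff_sum,
    Finsupp.finsetSum_apply, map_sum]
  have hterm (x : Set.Icc δ δ') : (evalAt lam).toRingHom
      ((LaurentPolynomial.C (MvPolynomial.X x) * LaurentPolynomial.T x.1.lvl :
        LaurentPolynomial (PolyAlg δ δ')).coeff r) = if x.1.lvl = r then coord lam x.1 else 0 := by
    rw [LaurentPolynomial.coeff_C_mul_T]
    split_ifs
    · exact evalAt_X lam x
    · exact map_zero _
  simp_rw [hterm]
  by_cases hr : coord lam ⟨α, r⟩ = 0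
  · refine (Finset.sum_eq_zero fun x hx => ?_).trans hr.symm
    split_ifs with hl
    · rw [← hr]
      exact congrArg _ (AffWt.ext (Finset.mem_filter.1 hx).2 hl)
    · rfl
  · rw [Finset.sum_eq_single ⟨⟨α, r⟩, h _ hr⟩]
    · exact if_pos rfl
    · intro x hx hne
      refine if_neg fun hl => hne (Subtype.ext (AffWt.ext (Finset.mem_filter.1 hx).2 hl))
    · simp

/-- A polynomial vanishes on the cell of `w` if it vanishes at all its points with coordinates in
integral domains. -/
def VanishesOn (w : AffWt) (f : PolyAlg δ δ') : Prop :=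
  ∀ (R : Type) [CommRing R] [IsDomain R] [Algebra ℂ R] (lam : SpinWt → LaurentPolynomial R),
    IsCellPoint w δ' lam → evalAt lam f = 0

theorem vanishesOn_of_mem_relIdeal {w : AffWt} (hw : δ ≤ w) {f : PolyAlg δ δ'}
    (hf : f ∈ relIdeal δ δ') : VanishesOn w f := by
  intro R _ _ _ lam hlam
  suffices h : relIdeal δ δ' ≤ RingHom.ker (evalAt lam) from h hf
  refine Ideal.span_le.2 ?_
  rintro _ ⟨s, l, rfl⟩
  have h := congrArg (fun p => p.coeff l) (pureSpinorQuadric_map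
    (AddMonoidAlgebra.mapRingHom ℤ (evalAt lam).toRingHom) (genFun δ δ') s)
  simp only [map_genFun fun x hx => ⟨hw.trans (hlam.support x hx).1, (hlam.support x hx).2⟩,
    hlam.quadric, AddMonoidAlgebra.coeff_mapRingHom] at h
  exact h.symm

theorem vanishesOn_of_arrow {w c : AffWt} (h : Arrow w c) {f : PolyAlg δ δ'}
    (hf : VanishesOn w f) : VanishesOn c f := by
  intro R _ _ _ lam hlam
  obtain ⟨lam', hlam', h'⟩ := hlam.act h
  have hcomp : (((Polynomial.aeval (0 : R)).restrictScalars ℂ).comp (evalAt lam') :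
      PolyAlg δ δ' →ₐ[ℂ] R) = evalAt lam := by
    refine MvPolynomial.algHom_ext fun x => ?_
    rw [AlgHom.comp_apply, evalAt_X, evalAt_X, ← h']
    simp [Polynomial.aeval_def, Polynomial.coeff_zero_eq_eval_zero]
  rw [← hcomp, AlgHom.comp_apply, hf _ lam' hlam', map_zero]

theorem vanishesOn_of_X_mul {w : Set.Icc δ δ'} {g : PolyAlg δ δ'}
    (h : VanishesOn w.1 (MvPolynomial.X w * g)) : VanishesOn w.1 g := by
  intro R _ _ _ lam hlam
  have h' := h R lam hlam
  rw [map_mul, evalAt_X] at h'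
  exact (mul_eq_zero.1 h').resolve_left hlam.ne_zero

theorem coeff_zero_of_vanishesOn {w : AffWt} (hw : w ≤ δ') {f : PolyAlg δ δ'}
    (hf : VanishesOn w f) : MvPolynomial.coeff 0 f = 0 := by
  obtain ⟨lam, hlam, h⟩ := exists_isCellPoint hw
  have hcomp : (((Polynomial.aeval (0 : ℂ))).comp (evalAt lam) : PolyAlg δ δ' →ₐ[ℂ] ℂ) =
      MvPolynomial.aeval 0 := by
    refine MvPolynomial.algHom_ext fun x => ?_
    rw [AlgHom.comp_apply, evalAt_X, MvPolynomial.aeval_X, Polynomial.coe_aeval_eq_eval, h]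
    rfl
  have h0 : (MvPolynomial.aeval 0 : PolyAlg δ δ' →ₐ[ℂ] ℂ) f = 0 := by
    rw [← hcomp, AlgHom.comp_apply, hf _ lam hlam, map_zero]
  rwa [MvPolynomial.aeval_zero] at h0

end Vanishing

end AffWt

/-! ## Standard monomials -/

namespace AffWt

variable {δ δ' : AffWt}

open Classical in
/-- The part of a polynomial consisting of the monomials in the variables above `c`. -/
noncomputable def truncate (c : AffWt) (f : PolyAlg δ δ') : PolyAlg δ δ' :=
  ∑ m ∈ f.support with ∀ x ∈ m.support, c ≤ x.1,
    MvPolynomial.monomial m (MvPolynomial.coeff m f)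

theorem sub_truncate_mem (c : AffWt) (f : PolyAlg δ δ') :
    f - truncate c f ∈ Ideal.span (MvPolynomial.X '' {x : Set.Icc δ δ' | ¬ c ≤ x.1}) := by
  classical
  have h : f - truncate c f = ∑ m ∈ f.support with ¬ ∀ x ∈ m.support, c ≤ x.1,
      MvPolynomial.monomial m (MvPolynomial.coeff m f) := by
    rw [sub_eq_iff_eq_add', truncate, Finset.sum_filter_add_sum_filter_not]
    exact (MvPolynomial.support_sum_monomial_coeff f).symm
  rw [h]
  refine Ideal.sum_mem _ fun m hm => ?_
  have hm' := (Finset.mem_filter.1 hm).2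
  push Not at hm'
  obtain ⟨x, hx, hcx⟩ := hm'
  rw [MvPolynomial.mem_ideal_span_X_image]
  intro m' hm'
  rw [Finset.mem_singleton.1 (MvPolynomial.support_monomial_subset hm')]
  exact ⟨x, hcx, Finsupp.mem_support_iff.1 hx⟩

theorem coeff_truncate_of_le {c : AffWt} {f : PolyAlg δ δ'} {m : Set.Icc δ δ' →₀ ℕ}
    (hm : ∀ x ∈ m.support, c ≤ x.1) :
    MvPolynomial.coeff m (truncate c f) = MvPolynomial.coeff m f := by
  classical
  rw [truncate, MvPolynomial.coeff_sum]
  simp_rw [MvPolynomial.coeff_monomial]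
  rw [Finset.sum_ite_eq']
  split_ifs with h
  · rfl
  · rw [Finset.mem_filter, not_and] at h
    by_contra h0
    exact h (MvPolynomial.mem_support_iff.2 (Ne.symm h0)) hm

theorem coeff_truncate_of_not_le {c : AffWt} {f : PolyAlg δ δ'} {m : Set.Icc δ δ' →₀ ℕ}
    (hm : ¬ ∀ x ∈ m.support, c ≤ x.1) : MvPolynomial.coeff m (truncate c f) = 0 := by
  classical
  rw [truncate, MvPolynomial.coeff_sum]
  simp_rw [MvPolynomial.coeff_monomial]
  rw [Finset.sum_ite_eq', if_neg fun h => hm (Finset.mem_filter.1 h).2]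

theorem vanishesOn_of_mem_span {w : AffWt} {f : PolyAlg δ δ'}
    (hf : f ∈ Ideal.span (MvPolynomial.X '' {x : Set.Icc δ δ' | ¬ w ≤ x.1})) :
    VanishesOn w f := by
  intro R _ _ _ lam hlam
  suffices h : Ideal.span (MvPolynomial.X '' {x : Set.Icc δ δ' | ¬ w ≤ x.1}) ≤
    RingHom.ker (evalAt lam : PolyAlg δ δ' →ₐ[ℂ] R) from h hf
  refine Ideal.span_le.2 ?_
  rintro _ ⟨x, hx, rfl⟩
  refine (evalAt_X lam x).trans ?_
  by_contra h0
  exact hx (hlam.support _ h0).1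

theorem VanishesOn.sub {w : AffWt} {f g : PolyAlg δ δ'} (hf : VanishesOn w f)
    (hg : VanishesOn w g) : VanishesOn w (f - g) := by
  intro R _ _ _ lam hlam
  rw [map_sub, hf R lam hlam, hg R lam hlam, sub_zero]

/-- A polynomial is standard if the variables in each of its monomials form a chain. -/
def IsStandard (f : PolyAlg δ δ') : Prop :=
  ∀ m ∈ f.support, IsChain (· ≤ ·) (m.support : Set (Set.Icc δ δ'))

theorem IsStandard.truncate {f : PolyAlg δ δ'} (hf : IsStandard f) (c : AffWt) :
    IsStandard (truncate c f) := by
  intro m hm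
  refine hf m (MvPolynomial.mem_support_iff.2 fun h => MvPolynomial.mem_support_iff.1 hm ?_)
  by_cases h' : ∀ x ∈ m.support, c ≤ x.1
  · rw [coeff_truncate_of_le h', h]
  · exact coeff_truncate_of_not_le h'

theorem le_of_mem_support_truncate {c : AffWt} {f : PolyAlg δ δ'} {m : Set.Icc δ δ' →₀ ℕ}
    (hm : m ∈ (truncate c f).support) : ∀ x ∈ m.support, c ≤ x.1 := by
  by_contra h
  exact MvPolynomial.mem_support_iff.1 hm (coeff_truncate_of_not_le h)

/-- Standard monomials in the variables above `w` are linearly independent on the cell of `w`. -/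
theorem eq_zero_of_isStandard_of_vanishesOn (w : Set.Icc δ δ') {f : PolyAlg δ δ'}
    (hf : IsStandard f) (hw : ∀ m ∈ f.support, ∀ x ∈ m.support, w ≤ x) (h : VanishesOn w.1 f) :
    f = 0 := by
  induction w using WellFoundedGT.induction generalizing f with
  | _ w ih =>
  induction hd : f.totalDegree using Nat.strong_induction_on generalizing f with
  | _ d ihd =>
  have hmw (m) (hm : m ∈ f.support) : m w ≠ 0 := by
    intro hmw
    have hm0 : m ≠ 0 := by
      rintro rfl
      exact MvPolynomial.mem_support_iff.1 hm (coeff_zero_of_vanishesOn w.2.2 h)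
    obtain ⟨x, hx⟩ := m.support.exists_minimal (Finsupp.support_nonempty_iff.2 hm0)
    have hxmin (y) (hy : y ∈ m.support) : x ≤ y := by
      by_cases hxy : x = y
      · exact hxy.le
      · rcases hf m hm hx.prop hy hxy with h | h
        exacts [h, hx.le_of_le hy h]
    have hwx : w < x := lt_of_le_of_ne (hw m hm x hx.prop) fun e =>
      Finsupp.mem_support_iff.1 hx.prop (e ▸ hmw)
    obtain ⟨c, hc, hcx⟩ := exists_arrow_le (show w.1 < x.1 from hwx)
    have hwc := lt_of_arrow hc
    let c' : Set.Icc δ δ' := ⟨c, w.2.1.trans hwc.le, hcx.trans x.2.2⟩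
    have hzero : AffWt.truncate c f = 0 := by
      refine ih c' hwc (hf.truncate c) (fun m hm => le_of_mem_support_truncate hm) ?_
      have := (vanishesOn_of_arrow hc h).sub (vanishesOn_of_mem_span (sub_truncate_mem c f))
      rwa [sub_sub_cancel] at this
    refine MvPolynomial.mem_support_iff.1 hm ?_
    rw [← coeff_truncate_of_le (c := c) fun y hy => hcx.trans (hxmin y hy), hzero,
      MvPolynomial.coeff_zero]
  have hdvd : MvPolynomial.X w ∣ f := by
    rw [← Ideal.mem_span_singleton, ← Set.image_singleton, MvPolynomial.mem_ideal_span_X_image]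
    exact fun m hm => ⟨w, rfl, hmw m hm⟩
  obtain ⟨g, rfl⟩ := hdvd
  by_contra hne
  have hg0 : g ≠ 0 := right_ne_zero_of_mul hne
  have hsupp (m) (hm : m ∈ g.support) :
      m + Finsupp.single w 1 ∈ (MvPolynomial.X w * g).support := by
    rw [MvPolynomial.mem_support_iff, add_comm, MvPolynomial.coeff_X_mul]
    exact MvPolynomial.mem_support_iff.1 hm
  have hsub (m : Set.Icc δ δ' →₀ ℕ) : m.support ⊆ (m + Finsupp.single w 1).support :=
    Finsupp.support_mono le_self_add
  refine hg0 (ihd g.totalDegree ?_ (fun m hm => (hf _ (hsupp m hm)).mono (hsub m))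
    (fun m hm x hx => hw _ (hsupp m hm) x (hsub m hx)) (vanishesOn_of_X_mul h) rfl)
  rw [← hd, MvPolynomial.totalDegree_mul_of_isDomain (MvPolynomial.X_ne_zero w) hg0,
    MvPolynomial.totalDegree_X]
  omega

end AffWt

/-! ## The Gröbner basis -/

namespace WordDegLex

variable {σ : Type*} [LinearOrder σ]

theorem single_add_single_lt [Finite σ] {x y a b : σ} (ha : x < a) (hb : x < b) :
    (wordOrder σ).toSyn (Finsupp.single x 1 + Finsupp.single y 1) <
      (wordOrder σ).toSyn (Finsupp.single a 1 + Finsupp.single b 1) := by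
  classical
  change (⟨Finsupp.single x 1 + Finsupp.single y 1⟩ : WordDegLex σ) <
    ⟨Finsupp.single a 1 + Finsupp.single b 1⟩
  rw [← not_le, le_iff]
  push Not
  simp only [map_add, Finsupp.degree_single, le_refl, true_and, forall_const]
  rw [Finsupp.Lex.lt_iff]
  refine ⟨min x y, fun j hj => ?_, ?_⟩
  · have hx : j < x := hj.trans_le (min_le_left _ _)
    have hy : j < y := hj.trans_le (min_le_right _ _)
    change (Finsupp.single a 1 + Finsupp.single b 1 : σ →₀ ℕ) j =
      (Finsupp.single x 1 + Finsupp.single y 1 : σ →₀ ℕ) j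
    simp [hx.ne', hy.ne', (hx.trans ha).ne', (hx.trans hb).ne']
  · change (Finsupp.single a 1 + Finsupp.single b 1 : σ →₀ ℕ) (min x y) <
      (Finsupp.single x 1 + Finsupp.single y 1 : σ →₀ ℕ) (min x y)
    have h₁ : a ≠ min x y := ((min_le_left x y).trans_lt ha).ne'
    have h₂ : b ≠ min x y := ((min_le_left x y).trans_lt hb).ne'
    rw [Finsupp.add_apply, Finsupp.single_eq_of_ne h₁.symm, Finsupp.single_eq_of_ne h₂.symm]
    rcases min_choice x y with h | h <;> simp [h]

end WordDegLex

theorem MonomialOrder.leadingTerm_mem_span_of_eq_linearCombination {σ k : Type*} [Field k]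
    {m : MonomialOrder σ} {B : Set (MvPolynomial σ k)} {f : MvPolynomial σ k}
    {g : B →₀ MvPolynomial σ k}
    (hf : f = Finsupp.linearCombination (MvPolynomial σ k) Subtype.val g)
    (hg : ∀ b, m.toSyn (m.degree (b.1 * g b)) ≤ m.toSyn (m.degree f)) :
    m.leadingTerm f ∈ Ideal.span (m.leadingTerm '' B) := by
  by_cases hf0 : f = 0
  · rw [hf0, MonomialOrder.leadingTerm_zero]
    exact Ideal.zero_mem _
  have hsupp := (MonomialOrder.degree_mem_support_iff (m := m) f).2 hf0
  obtain ⟨b, hb⟩ : ∃ b, m.degree f ∈ (b.1 * g b).support := by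
    by_contra! h
    have h0 : MvPolynomial.coeff (m.degree f) (Finsupp.linearCombination (MvPolynomial σ k)
        Subtype.val g) = 0 := by
      rw [Finsupp.linearCombination_apply, Finsupp.sum, MvPolynomial.coeff_sum]
      refine Finset.sum_eq_zero fun b _ => ?_
      rw [smul_eq_mul, mul_comm]
      exact MvPolynomial.notMem_support_iff.1 (h b)
    rw [← hf] at h0
    exact MvPolynomial.mem_support_iff.1 hsupp h0
  have hne : b.1 * g b ≠ 0 := fun h => by simp [h] at hb
  have hdeg : m.degree (b.1 * g b) = m.degree f :=
    m.toSyn.injective (le_antisymm (hg b) (MonomialOrder.le_degree hb))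
  have hlt : m.leadingTerm f = MvPolynomial.C (m.leadingCoeff f * (m.leadingCoeff (b.1 * g b))⁻¹) *
      m.leadingTerm (b.1 * g b) := by
    rw [MonomialOrder.leadingTerm, MonomialOrder.leadingTerm, MvPolynomial.C_mul_monomial, hdeg,
      mul_assoc, inv_mul_cancel₀ (MonomialOrder.leadingCoeff_ne_zero_iff.2 hne), mul_one]
  rw [hlt, MonomialOrder.leadingTerm_mul]
  exact Ideal.mul_mem_left _ _ (Ideal.mul_mem_right _ _ (Ideal.subset_span ⟨b, b.2, rfl⟩))

namespace AffWt

variable {δ δ' : AffWt}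

theorem exists_degree_quadric {a b : Set.Icc δ δ'} (hab : ¬ a ≤ b) (hba : ¬ b ≤ a) :
    ∃ q ∈ quadrics δ δ', q ≠ 0 ∧
      (monomialOrder δ δ').degree q = Finsupp.single a 1 + Finsupp.single b 1 := by
  classical
  obtain ⟨s, l, ε, hε, h⟩ := exists_quadric_sub_mem hab hba
  set m := monomialOrder δ δ' with hm
  set d := quadric δ δ' s l - MvPolynomial.C ε * (MvPolynomial.X a * MvPolynomial.X b) with hd
  have hX : MvPolynomial.C ε * (MvPolynomial.X a * MvPolynomial.X b) =
      MvPolynomial.monomial (Finsupp.single a 1 + Finsupp.single b 1) ε := by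
    rw [MvPolynomial.X, MvPolynomial.X, MvPolynomial.monomial_mul, MvPolynomial.C_mul_monomial,
      mul_one, mul_one]
  have hq : quadric δ δ' s l =
      MvPolynomial.monomial (Finsupp.single a 1 + Finsupp.single b 1) ε + d := by
    rw [hd, hX, add_sub_cancel]
  have hne : Finsupp.single a 1 + Finsupp.single b 1 ≠ 0 := fun h0 => by
    have := DFunLike.congr_fun h0 a
    simp at this
  have hdeg : m.degree (MvPolynomial.monomial (Finsupp.single a 1 + Finsupp.single b 1) ε) =
      Finsupp.single a 1 + Finsupp.single b 1 := by
    rw [MonomialOrder.degree_monomial, if_neg hε]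
  have hlt : m.toSyn (m.degree d) < m.toSyn (m.degree
      (MvPolynomial.monomial (Finsupp.single a 1 + Finsupp.single b 1) ε)) := by
    rw [hdeg, MonomialOrder.degree_lt_iff]
    · intro c hc
      obtain ⟨x, y, hx, hy, rfl⟩ := (MvPolynomial.mem_restrictSupport_iff ℂ).1 h hc
      exact @WordDegLex.single_add_single_lt _ (genOrder δ δ') _ _ _ _ _ (pos_strictMono hx)
        (pos_strictMono hy)
    · rw [map_zero, MonomialOrder.toSyn_lt_iff_ne_zero]
      exact fun h0 => hne (m.toSyn_eq_zero_iff _ |>.1 h0)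
  have hdeg' := MonomialOrder.degree_add_of_lt hlt
  rw [← hq, hdeg] at hdeg'
  refine ⟨_, ⟨s, l, rfl⟩, fun h0 => hne ?_, hdeg'⟩
  rw [← hdeg', h0, MonomialOrder.degree_zero]

theorem exists_standard_remainder (f : PolyAlg δ δ') :
    ∃ (g : (quadrics δ δ' \ {0} : Set (PolyAlg δ δ')) →₀ PolyAlg δ δ') (r : PolyAlg δ δ'),
      f = Finsupp.linearCombination (PolyAlg δ δ') Subtype.val g + r ∧
      (∀ b, (monomialOrder δ δ').toSyn ((monomialOrder δ δ').degree (b.1 * g b)) ≤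
        (monomialOrder δ δ').toSyn ((monomialOrder δ δ').degree f)) ∧ IsStandard r := by
  obtain ⟨g, r, hf, hg, hr⟩ := (monomialOrder δ δ').div_set (B := quadrics δ δ' \ {0})
    (fun b hb => isUnit_iff_ne_zero.2 (MonomialOrder.leadingCoeff_ne_zero_iff.2 hb.2)) f
  refine ⟨g, r, hf, hg, fun c hc a ha b hb hab => ?_⟩
  by_contra! h
  obtain ⟨q, hq, hq0, hdeg⟩ := exists_degree_quadric h.1 h.2
  refine hr c hc q ⟨hq, hq0⟩ ?_
  rw [hdeg]
  intro x
  have ha' := Finsupp.mem_support_iff.1 ha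
  have hb' := Finsupp.mem_support_iff.1 hb
  classical
  rw [Finsupp.add_apply, Finsupp.single_apply, Finsupp.single_apply]
  split_ifs with h₁ h₂ h₂
  · exact absurd (h₁.trans h₂.symm) hab
  · subst h₁; omega
  · subst h₂; omega
  · omega

theorem linearCombination_mem_relIdeal
    (g : (quadrics δ δ' \ {0} : Set (PolyAlg δ δ')) →₀ PolyAlg δ δ') :
    Finsupp.linearCombination (PolyAlg δ δ') Subtype.val g ∈ relIdeal δ δ' := by
  rw [Finsupp.linearCombination_apply]
  exact Submodule.sum_mem _ fun b _ => Ideal.mul_mem_left _ _ (Ideal.subset_span b.2.1)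

theorem constantCoeff_of_mem_relIdeal {f : PolyAlg δ δ'} (hf : f ∈ relIdeal δ δ') :
    MvPolynomial.constantCoeff f = 0 := by
  suffices h : relIdeal δ δ' ≤ RingHom.ker MvPolynomial.constantCoeff from h hf
  refine Ideal.span_le.2 ?_
  rintro _ ⟨s, l, rfl⟩
  exact (quadric_isHomogeneous δ δ' s l).coeff_eq_zero (by simp)

theorem eq_zero_of_isStandard_of_mem_relIdeal {r : PolyAlg δ δ'} (hr : IsStandard r)
    (hmem : r ∈ relIdeal δ δ') : r = 0 := by
  by_cases h : δ ≤ δ'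
  · exact eq_zero_of_isStandard_of_vanishesOn ⟨δ, le_rfl, h⟩ hr (fun _ _ x _ => x.2.1)
      (vanishesOn_of_mem_relIdeal le_rfl hmem)
  · have : IsEmpty (Set.Icc δ δ') := ⟨fun x => h (x.2.1.trans x.2.2)⟩
    ext m
    rw [Subsingleton.elim m 0]
    exact constantCoeff_of_mem_relIdeal hmem

theorem isQuadraticGroebnerBasis (δ δ' : AffWt) :
    IsQuadraticGroebnerBasis (monomialOrder δ δ') (quadrics δ δ') (relIdeal δ δ') where
  subset := Ideal.subset_span
  quadratic := by
    rintro _ ⟨s, l, rfl⟩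
    exact quadric_isHomogeneous δ δ' s l
  span_leadingTerm := by
    refine le_antisymm (Ideal.span_mono (Set.image_mono Ideal.subset_span)) (Ideal.span_le.2 ?_)
    rintro _ ⟨f, hf, rfl⟩
    obtain ⟨g, r, hfr, hg, hr⟩ := exists_standard_remainder f
    have hr0 : r = 0 := by
      refine eq_zero_of_isStandard_of_mem_relIdeal hr ?_
      have := (relIdeal δ δ').sub_mem hf (linearCombination_mem_relIdeal g)
      rwa [hfr, add_sub_cancel_left] at this
    rw [hr0, add_zero] at hfr
    exact Ideal.span_mono (Set.image_mono Set.sdiff_subset)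
      (MonomialOrder.leadingTerm_mem_span_of_eq_linearCombination hfr hg)

end AffWt

/-! ## The Koszul filtration -/

namespace AffWt

variable {δ δ' : AffWt}

/-- The generators of the algebra `A`. -/
noncomputable def gen (x : Set.Icc δ δ') : RichAlg δ δ' :=
  Ideal.Quotient.mk (relIdeal δ δ') (MvPolynomial.X x)

theorem span_gen (D : Set (Set.Icc δ δ')) :
    Ideal.span (gen '' D) = (Ideal.span (MvPolynomial.X '' D)).map
      (Ideal.Quotient.mk (relIdeal δ δ')) := by
  rw [Ideal.map_span, Set.image_image]
  rfl

/-- The product of two incomparable generators lies in the ideal of the smaller ones. -/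
theorem gen_mul_gen_mem {a b : Set.Icc δ δ'} (hab : ¬ a ≤ b) (hba : ¬ b ≤ a) :
    gen a * gen b ∈ Ideal.span (gen '' Set.Iio b) := by
  obtain ⟨s, l, ε, hε, h⟩ := exists_quadric_sub_mem hab hba
  set d := quadric δ δ' s l - MvPolynomial.C ε * (MvPolynomial.X a * MvPolynomial.X b) with hd
  have hdmem : d ∈ Ideal.span (MvPolynomial.X '' Set.Iio b) := by
    rw [MvPolynomial.mem_ideal_span_X_image]
    intro m hm
    obtain ⟨x, y, hx, hy, rfl⟩ := (MvPolynomial.mem_restrictSupport_iff ℂ).1 h hm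
    exact ⟨x, hy, by simp⟩
  have hX : MvPolynomial.X a * MvPolynomial.X b =
      MvPolynomial.C ε⁻¹ * (quadric δ δ' s l - d) := by
    rw [hd, sub_sub_cancel, ← mul_assoc, ← map_mul, inv_mul_cancel₀ hε, map_one, one_mul]
  have hq : Ideal.Quotient.mk (relIdeal δ δ') (quadric δ δ' s l) = 0 :=
    Ideal.Quotient.eq_zero_iff_mem.2 (Ideal.subset_span ⟨s, l, rfl⟩)
  rw [gen, gen, ← map_mul, hX, map_mul, map_sub, hq, zero_sub, span_gen]
  exact Ideal.mul_mem_left _ _ ((Ideal.neg_mem_iff _).2 (Ideal.mem_map_of_mem _ hdmem))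

theorem mul_gen_mem {D : Set (Set.Icc δ δ')} (hD : IsLowerSet D) {w : Set.Icc δ δ'}
    (hw : w ∈ D) {u : RichAlg δ δ'}
    (hu : u ∈ Ideal.span (gen '' {y : Set.Icc δ δ' | ¬ w.1 ≤ y.1})) :
    u * gen w ∈ Ideal.span (gen '' (D ∩ {y | y.1.pos < w.1.pos})) := by
  have hsub : Set.Iio w ⊆ D ∩ {y | y.1.pos < w.1.pos} :=
    fun y hy => ⟨hD (le_of_lt hy) hw, pos_strictMono hy⟩
  induction hu using Submodule.span_induction with
  | mem v hv =>
    obtain ⟨y, hy, rfl⟩ := hv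
    by_cases hyw : y ≤ w
    · exact Ideal.mul_mem_right _ _ (Ideal.subset_span
        ⟨y, hsub (lt_of_le_of_ne hyw fun e => hy (e ▸ le_rfl)), rfl⟩)
    · exact Ideal.span_mono (Set.image_mono hsub) (gen_mul_gen_mem hyw hy)
  | zero =>
    rw [zero_mul]
    exact Ideal.zero_mem _
  | add v v' _ _ h h' =>
    rw [add_mul]
    exact Ideal.add_mem _ h h'
  | smul a v _ h =>
    rw [smul_eq_mul, mul_assoc]
    exact Ideal.mul_mem_left _ _ h

/-- Every element of `A` is congruent, modulo the generators which are not above `w`, to a standard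
polynomial in the generators above `w`. -/
theorem exists_standard_sub_mem (w : Set.Icc δ δ') (u : RichAlg δ δ') :
    ∃ r : PolyAlg δ δ', IsStandard r ∧ (∀ m ∈ r.support, ∀ x ∈ m.support, w ≤ x) ∧
      u - Ideal.Quotient.mk (relIdeal δ δ') r ∈
        Ideal.span (gen '' {y : Set.Icc δ δ' | ¬ w.1 ≤ y.1}) := by
  obtain ⟨f, rfl⟩ := Ideal.Quotient.mk_surjective u
  obtain ⟨g, r, hf, -, hr⟩ := exists_standard_remainder f
  have hfr : Ideal.Quotient.mk (relIdeal δ δ') f = Ideal.Quotient.mk (relIdeal δ δ') r := by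
    rw [Ideal.Quotient.eq, hf, add_sub_cancel_right]
    exact linearCombination_mem_relIdeal g
  refine ⟨truncate w.1 r, hr.truncate w.1, fun m hm => le_of_mem_support_truncate hm, ?_⟩
  rw [hfr, ← map_sub, span_gen]
  exact Ideal.mem_map_of_mem _ (sub_truncate_mem w.1 r)

/-- A standard polynomial in the generators above `w` is zero if its multiple by the generator `w`
is in the ideal of the generators which are not above `w`. -/
theorem eq_zero_of_mul_gen_mem {w : Set.Icc δ δ'} {r : PolyAlg δ δ'} (hr : IsStandard r)
    (hr' : ∀ m ∈ r.support, ∀ x ∈ m.support, w ≤ x)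
    (h : Ideal.Quotient.mk (relIdeal δ δ') r * gen w ∈
      Ideal.span (gen '' {y : Set.Icc δ δ' | ¬ w.1 ≤ y.1})) : r = 0 := by
  rw [gen, ← map_mul, span_gen,
    Ideal.mem_map_iff_of_surjective _ Ideal.Quotient.mk_surjective] at h
  obtain ⟨j, hj, hjr⟩ := h
  have hv := (vanishesOn_of_mem_span hj).sub
    (vanishesOn_of_mem_relIdeal w.2.1 (Ideal.Quotient.eq.1 hjr))
  rw [sub_sub_cancel, mul_comm] at hv
  exact eq_zero_of_isStandard_of_vanishesOn w hr hr' (vanishesOn_of_X_mul hv)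

/-- The colon ideals of the ideals generated by lower sets of generators. -/
theorem mul_gen_mem_iff {D : Set (Set.Icc δ δ')} (hD : IsLowerSet D) {w : Set.Icc δ δ'}
    (hw : w ∈ D) (u : RichAlg δ δ') :
    u * gen w ∈ Ideal.span (gen '' (D ∩ {y | y.1.pos < w.1.pos})) ↔
      u ∈ Ideal.span (gen '' {y : Set.Icc δ δ' | ¬ w.1 ≤ y.1}) := by
  refine ⟨fun hu => ?_, mul_gen_mem hD hw⟩
  obtain ⟨r, hr, hr', hur⟩ := exists_standard_sub_mem w u
  have h := Ideal.sub_mem _ hu (mul_gen_mem hD hw hur)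
  rw [← sub_mul, sub_sub_cancel] at h
  have hsub : D ∩ {y | y.1.pos < w.1.pos} ⊆ {y | ¬ w.1 ≤ y.1} :=
    fun y hy hwy => (pos_mono hwy).not_gt hy.2
  have h0 := eq_zero_of_mul_gen_mem hr hr' (Ideal.span_mono (Set.image_mono hsub) h)
  rwa [h0, map_zero, sub_zero] at hur

theorem isKoszulFiltration (δ δ' : AffWt) :
    @IsKoszulFiltration _ _ _ (genOrder δ δ') (gen (δ := δ) (δ' := δ')) {D | IsLowerSet D} := by
  intro D hD w hw
  refine ⟨{y | ¬ w.1 ≤ y.1}, fun y z hzy hy hz => hy (le_trans hz hzy), fun u => ?_⟩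
  exact mul_gen_mem_iff hD hw u

/-! ## The grading -/

theorem mk_mem_richGrading {n : ℕ} {p : PolyAlg δ δ'} (hp : p.IsHomogeneous n) :
    Ideal.Quotient.mk (relIdeal δ δ') p ∈ richGrading δ δ' n :=
  ⟨p, hp, rfl⟩

theorem gen_mem_richGrading (x : Set.Icc δ δ') : gen x ∈ richGrading δ δ' 1 :=
  mk_mem_richGrading (MvPolynomial.isHomogeneous_X ℂ x)

instance : SetLike.GradedMonoid (richGrading δ δ') where
  one_mem := mk_mem_richGrading (MvPolynomial.isHomogeneous_one _ _)
  mul_mem := by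
    rintro i j _ _ ⟨p, hp, rfl⟩ ⟨q, hq, rfl⟩
    exact mk_mem_richGrading (MvPolynomial.IsHomogeneous.mul hp hq)

theorem homogeneousComponent_mem_relIdeal {p : PolyAlg δ δ'} (hp : p ∈ relIdeal δ δ') (n : ℕ) :
    MvPolynomial.homogeneousComponent n p ∈ relIdeal δ δ' := by
  let _ := MvPolynomial.gradedAlgebra (σ := Set.Icc δ δ') (R := ℂ)
  have h := Ideal.homogeneous_span (MvPolynomial.homogeneousSubmodule (Set.Icc δ δ') ℂ)
    (quadrics δ δ') (by
      rintro _ ⟨s, l, rfl⟩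
      exact ⟨2, quadric_isHomogeneous δ δ' s l⟩) n hp
  exact (MvPolynomial.decomposition.decompose'_apply p n) ▸ h

theorem isInternal_richGrading (δ δ' : AffWt) : DirectSum.IsInternal (richGrading δ δ') := by
  classical
  refine ⟨(injective_iff_map_eq_zero _).2 fun v hv => ?_, fun a => ?_⟩
  · choose p hp hpv using fun n => (v n).2
    have hsum : ∑ n ∈ v.support, p n ∈ relIdeal δ δ' := by
      rw [← Ideal.Quotient.eq_zero_iff_mem, map_sum, ← hv, DirectSum.coeAddMonoidHom_eq_dfinsuppSum,
        DFinsupp.sum]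
      exact Finset.sum_congr rfl fun n _ => hpv n
    ext n
    by_cases hn : n ∈ v.support
    · have h := homogeneousComponent_mem_relIdeal hsum n
      rw [map_sum, Finset.sum_eq_single n, MvPolynomial.homogeneousComponent_of_mem (hp n),
        if_pos rfl, ← Ideal.Quotient.eq_zero_iff_mem] at h
      · exact (hpv n).symm.trans h
      · intro b _ hb
        rw [MvPolynomial.homogeneousComponent_of_mem (hp b), if_neg hb.symm]
      · exact fun h' => absurd hn h'
    · rw [DFinsupp.notMem_support_iff.1 hn]
      rfl
  · obtain ⟨p, rfl⟩ := Ideal.Quotient.mk_surjective a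
    refine ⟨∑ n ∈ Finset.range (p.totalDegree + 1), DirectSum.of (fun n => richGrading δ δ' n) n
      ⟨_, mk_mem_richGrading (MvPolynomial.homogeneousComponent_isHomogeneous n p)⟩, ?_⟩
    rw [map_sum]
    simp only [DirectSum.coeAddMonoidHom_of]
    rw [← map_sum, MvPolynomial.sum_homogeneousComponent]

theorem richGrading_zero (δ δ' : AffWt) : richGrading δ δ' 0 = 1 := by
  rw [richGrading, MvPolynomial.homogeneousSubmodule_zero]
  exact Submodule.map_one _

theorem positiveIdeal_richGrading (δ δ' : AffWt) :
    positiveIdeal (richGrading δ δ') = Ideal.span (Set.range gen) := by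
  refine le_antisymm (Ideal.span_le.2 ?_) (Ideal.span_mono ?_)
  · rintro _ ⟨n, hn, p, hp, rfl⟩
    rw [← Set.image_univ, SetLike.mem_coe, span_gen]
    refine Ideal.mem_map_of_mem _ ?_
    rw [MvPolynomial.mem_ideal_span_X_image]
    intro m hm
    by_contra! h
    have hm0 : m = 0 := Finsupp.ext fun i => h i trivial
    have := hp (MvPolynomial.mem_support_iff.1 hm)
    simp [hm0] at this
    omega
  · rintro _ ⟨x, rfl⟩
    exact ⟨1, one_pos, gen_mem_richGrading x⟩

instance : Nontrivial (RichAlg δ δ') :=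
  Ideal.Quotient.nontrivial_iff.2 fun h => by
    have := constantCoeff_of_mem_relIdeal (f := (1 : PolyAlg δ δ')) (h ▸ Submodule.mem_top)
    simp at this

theorem isKoszul_richGrading (δ δ' : AffWt) : IsKoszul (richGrading δ δ') := by
  let _ : DirectSum.Decomposition (richGrading δ δ') :=
    (isInternal_richGrading δ δ').chooseDecomposition
  let _ : GradedAlgebra (richGrading δ δ') := { }
  exact @IsKoszulFiltration.isKoszul _ _ _ _ _ _ _ (genOrder δ δ') _ _ _ _ _
    (isKoszulFiltration δ δ') gen_mem_richGrading isLowerSet_univ (richGrading_zero δ δ')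
    (positiveIdeal_richGrading δ δ')

end AffWt

theorem corollaryP (δ δ' : AffWt) :
    IsQuadraticGroebnerBasis (AffWt.monomialOrder δ δ') (AffWt.quadrics δ δ')
      (AffWt.relIdeal δ δ') ∧
    IsKoszul (AffWt.richGrading δ δ') :=
  ⟨AffWt.isQuadraticGroebnerBasis δ δ', AffWt.isKoszul_richGrading δ δ'⟩
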